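/- Throughout, $N\in\{0,1,2,\dots\}\cup\{\infty\}$ and $\Gamma$ is a rooted, locally finite tree with root $\rho$, all of whose maximal paths from the root (rays) have length $N$; thus if $N=\infty$ the tree is infinite and has no leaves. Let $|\sigma|$ be the distance from $\rho$ to $\sigma$, $\Gamma_n=\{\sigma:|\sigma|=n\}$, $|\Gamma_n|$ its cardinality, and $\partial\Gamma$ the set of rays. *Target percolation.* Let $\{X(\sigma):\sigma\ne\rho\}$ be i.i.d. real random variables with common law $\mu$, and let $X$ have law $\mu$. Let $B\subseteq\mathbb R^N$ be closed (product topology) and let $\pi_kB$ be its projection on the first $k$ coordinates. The random set $W$ contains $\rho$, and contains $\sigma\in\Gamma_k$, $k\ge1$, iff $(X(\tau_1),\dots,X(\tau_k))\in\pi_kB$, where $\rho,\tau_1,\dots,\tau_k=\sigma$ is the path from $\rho$ to $\sigma$. Write $\mathbf P(B;\rho\leftrightarrow\sigma)$ (resp. $\mathbf P(B;\rho\leftrightarrow\partial\Gamma)$) for the probability that $W$ contains the path from $\rho$ to $\sigma$ (resp. some ray of $\Gamma$). For $\sigma\in\Gamma_n$, the probability $\mathbf P(B;\rho\leftrightarrow\sigma)=:p(B;n)$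 depends only on $n$: $p(B;0)=1$, and $p(B;n)=\mu^{\otimes n}(\pi_nB)$ for $n\ge1$. *Virtual spherically symmetric trees.* For $f(1),f(2),\dots>0$ put $\Psi_\mu(B;a)=\mathbf P(X\notin B)^a$ for $B\subseteq\mathbb R$, and $\Psi_\mu(B;a_1,\dots,a_n)=\bigl[\mathbf E\,\Psi_\mu(B/X;a_2,\dots,a_n)\bigr]^{a_1}$ for $B\subseteq\mathbb R^n$, $n\ge2$, where $B/x=\{y:(x,y)\in B\}$. Let $f(n)=|\Gamma_n|/|\Gamma_{n-1}|$ for $1\le n\le N$, and let $\mathcal S(\Gamma)$ denote the (virtual) spherically symmetric tree with growth function $f$. By definition, $\mathbf P(B;\rho\leftrightarrow\partial\mathcal S(\Gamma))=1-\Psi_\mu(B;f(1),\dots,f(N))$ if $1\le N<\infty$; it is $\lim_{n\to\infty}\bigl(1-\Psi_\mu(\pi_nB;f(1),\dots,f(n))\bigr)$ if $N=\infty$; and it is $1$ if $N=0$. *Product target.* Let $\nu$ be a probability law on $\mathbb R$ (for instance $\nu=\mu$) and let $b_i\in[-\infty,\infty]$ be such that $\prod_{i=1}^n\nu((-\infty,b_i]\cap\mathbb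 R)=p(B;n)$ for all finite $n\le N$. Let $\mathcal S(B)=\{y\in\mathbb R^N:y_i\le b_i\text{ for all finite }i\le N\}$, and define $\mathbf P(\mathcal S(B);\rho\leftrightarrow\partial\mathcal S(\Gamma))$ as above with labels of law $\nu$. *Capacity.* For a tree $\Lambda$ of height $N$ and rays $\xi,\eta$ of $\Lambda$, let $|\xi\wedge\eta|$ be the depth of their last common vertex ($=N$ if $\xi=\eta$). Write $p(k)=p(B;k)$ and $p(\infty)=\lim_n p(n)$. Then $\mathrm{Cap}_p(\Lambda)^{-1}=\inf_m\iint p(|\xi\wedge\eta|)^{-1}\,dm(\xi)\,dm(\eta)$, the infimum being over Borel probability measures $m$ on $\partial\Lambda$. All expressions are computed in $[0,\infty]$ with $0^{-1}=\infty$, $\infty^{-1}=0$, $0\cdot\infty=0$. **Theorem 4.2.** With the above notation: 1. If $\nu$ has no atoms, then numbers $b_i$ as above exist. 2. For every $\nu$ and every choice of such $b_i$, $$\mathbf P(B;\rho\leftrightarrow\partial\Gamma)\le\mathbf P(B;\rho\leftrightarrow\partial\mathcal S(\Gamma))\le\mathbf P(\mathcal S(B);\rho\leftrightarrow\partial\mathcal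 S(\Gamma))\le R,$$ where $$R=2\Bigl[p(B;N)^{-1}|\Gamma_N|^{-1}+\sum_{0\le k<N}p(B;k)^{-1}\bigl(|\Gamma_k|^{-1}-|\Gamma_{k+1}|^{-1}\bigr)\Bigr]^{-1},$$ the term $p(B;N)^{-1}|\Gamma_N|^{-1}$ being present only if $N<\infty$. 3. If $f(n)$ is an integer for all $1\le n\le N$, then $\mathcal S(\Gamma)$ exists as a tree: there is a tree $\Lambda$ of height $N$ in which every vertex at distance $n-1$ from the root has exactly $f(n)$ children, for $1\le n\le N$. If moreover $N<\infty$ or $\sup_n|\Gamma_n|=\infty$, then $R=2\,\mathrm{Cap}_p(\Lambda)$ for every such tree $\Lambda$ (that is, $R=2\,\mathrm{Cap}_p(\mathcal S(\Gamma))$). -/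

import Mathlib

open MeasureTheory ProbabilityTheory
open scoped ENNReal

universe u

noncomputable section

/-- A rooted, locally finite tree of height `N ≤ ∞` all of whose maximal paths from the root have
length `N` (so for `N = ∞` the tree is infinite without leaves). It is given by its levels
`Γ₀, Γ₁, …`, where `level n` is the set of vertices at distance `n` from the root, and by the map
sending a vertex other than the root to its parent. -/
structure LevelTree (N : ℕ∞) where
  /-- The vertices at distance `n` from the root. -/
  level : ℕ → Type u
  /-- The neighbour of a vertex that is closer to the root. -/
  parent : ∀ n : ℕ, level (n + 1) → level n
  /-- The root. -/
  root : level 0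
  eq_root : ∀ σ : level 0, σ = root
  finite_level : ∀ n : ℕ, Finite (level n)
  /-- Every vertex at a level below `N` has a child. -/
  exists_child : ∀ n : ℕ, ((n + 1 : ℕ) : ℕ∞) ≤ N → Function.Surjective (parent n)
  /-- There are no vertices beyond the height. -/
  isEmpty_level : ∀ n : ℕ, N < (n : ℕ∞) → IsEmpty (level n)

namespace LevelTree

variable {N : ℕ∞}

/-- The number `|Γ_n|` of vertices at distance `n` from the root. -/
def card (Γ : LevelTree.{u} N) (n : ℕ) : ℕ := Nat.card (Γ.level n)

/-- The growth numbers of the spherical symmetrization: with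
`f(n) = |Γ_n| / |Γ_{n-1}|` for `n ≥ 1`, the value `Γ.growth n` is `f(n+1)`. -/
def growth (Γ : LevelTree.{u} N) (n : ℕ) : ℝ := (Γ.card (n + 1) : ℝ) / (Γ.card n : ℝ)

/-- `Γ` is spherically symmetric with growth function `f`: every vertex of level `n < N` has exactly
`f n` children in level `n + 1`. -/
def IsSphericallySymmetric (Γ : LevelTree.{u} N) (f : ℕ → ℝ) : Prop :=
  ∀ n : ℕ, ((n + 1 : ℕ) : ℕ∞) ≤ N → ∀ σ : Γ.level n,
    (Nat.card {τ : Γ.level (n + 1) // Γ.parent n τ = σ} : ℝ) = f n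

/-- The vertices other than the root. -/
abbrev NonRoot (Γ : LevelTree.{u} N) : Type u := Σ n : ℕ, Γ.level (n + 1)

/-- A ray: a path from the root through one vertex of each level `n ≤ N`. The type of rays is the
boundary `∂Γ`. -/
structure Ray (Γ : LevelTree.{u} N) where
  /-- The vertex of the ray in level `n`. -/
  vertex : ∀ n : ℕ, (n : ℕ∞) ≤ N → Γ.level n
  parent_vertex : ∀ (n : ℕ) (h : (n : ℕ∞) ≤ N) (h' : ((n + 1 : ℕ) : ℕ∞) ≤ N),
    Γ.parent n (vertex (n + 1) h') = vertex n h

/-- The σ-algebra on `∂Γ` generated by the cylinders `{ξ | ξ passes through σ}`, i.e. the Borel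
σ-algebra of the boundary. -/
instance (Γ : LevelTree.{u} N) : MeasurableSpace Γ.Ray :=
  MeasurableSpace.generateFrom
    {s | ∃ (n : ℕ) (h : (n : ℕ∞) ≤ N) (σ : Γ.level n), s = {ξ : Γ.Ray | ξ.vertex n h = σ}}

/-- `|ξ ∧ η|`, the distance from the root to the last common vertex of two rays
(equal to `N` when `ξ = η`). -/
def meetDepth (Γ : LevelTree.{u} N) (ξ η : Γ.Ray) : ℕ∞ :=
  ⨆ (n : ℕ) (h : (n : ℕ∞) ≤ N) (_ : ξ.vertex n h = η.vertex n h), (n : ℕ∞)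

/-- A gauge `φ` evaluated at a depth in `{0, 1, …, ∞}`; for a nonincreasing `φ` the value at `∞`
is `lim φ(n) = inf φ(n)`. -/
def gaugeAt (φ : ℕ → ℝ≥0∞) (m : ℕ∞) : ℝ≥0∞ :=
  if m = ⊤ then ⨅ n : ℕ, φ n else φ m.toNat

/-- The energy `I_φ(m) = ∫∫ φ(|ξ ∧ η|)⁻¹ dm(ξ) dm(η)`. -/
def energy (Γ : LevelTree.{u} N) (φ : ℕ → ℝ≥0∞) (m : Measure Γ.Ray) : ℝ≥0∞ :=
  ∫⁻ ξ, ∫⁻ η, (gaugeAt φ (Γ.meetDepth ξ η))⁻¹ ∂m ∂m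

/-- The capacity in gauge `φ`: the reciprocal of the infimum of the energy over all probability
measures on the boundary. -/
def capacity (Γ : LevelTree.{u} N) (φ : ℕ → ℝ≥0∞) : ℝ≥0∞ :=
  (⨅ (m : Measure Γ.Ray) (_ : IsProbabilityMeasure m), Γ.energy φ m)⁻¹

/-- For a labelling `x` of the non-root vertices and a vertex `σ` of level `k`, with path
`ρ, τ₁, …, τ_k = σ` from the root, the vector `(x(τ₁), …, x(τ_k))`. -/
def labels (Γ : LevelTree.{u} N) (x : Γ.NonRoot → ℝ) : ∀ k : ℕ, Γ.level k → (Fin k → ℝ)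
  | 0, _ => Fin.elim0
  | k + 1, σ => Fin.snoc (labels Γ x k (Γ.parent k σ)) (x ⟨k, σ⟩)

end LevelTree

/-- The space `ℝ^N`, `N ≤ ∞` (coordinates are numbered from `0`), with the product topology. -/
abbrev RPow (N : ℕ∞) : Type := {i : ℕ // (i : ℕ∞) < N} → ℝ

/-- The projection `π_k B` of `B ⊆ ℝ^N` on the first `k` coordinates (meaningful for `k ≤ N`;
for `k = N < ∞` this is `B` itself). -/
def projSet {N : ℕ∞} (B : Set (RPow N)) (k : ℕ) : Set (Fin k → ℝ) :=
  {z | ∃ y ∈ B, ∀ (i : Fin k) (h : ((i : ℕ) : ℕ∞) < N), z i = y ⟨i, h⟩}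

namespace LevelTree

variable {N : ℕ∞}

/-- The event `σ ∈ W` for the target percolation with target set `B` and labels `x`; the root is
always in `W`. -/
def InW (Γ : LevelTree.{u} N) (B : Set (RPow N)) (x : Γ.NonRoot → ℝ) (k : ℕ) (σ : Γ.level k) :
    Prop :=
  k = 0 ∨ Γ.labels x k σ ∈ projSet B k

/-- The event `ρ ↔ σ`: the whole path from the root to `σ` lies in `W`. -/
def ConnVertex (Γ : LevelTree.{u} N) (B : Set (RPow N)) (x : Γ.NonRoot → ℝ) :
    ∀ k : ℕ, Γ.level k → Prop
  | 0, σ => Γ.InW B x 0 σ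
  | k + 1, σ => ConnVertex Γ B x k (Γ.parent k σ) ∧ Γ.InW B x (k + 1) σ

/-- The event `ρ ↔ ∂Γ`: `W` contains a ray. -/
def ConnBoundary (Γ : LevelTree.{u} N) (B : Set (RPow N)) (x : Γ.NonRoot → ℝ) : Prop :=
  ∃ ξ : Γ.Ray, ∀ (n : ℕ) (h : (n : ℕ∞) ≤ N), Γ.InW B x n (ξ.vertex n h)

end LevelTree

/-- The level probability `p(B; n) = P(ρ ↔ σ)`, `|σ| = n`, of the target percolation with target
set `B` and labels of law `μ`: the probability that `(X₁, …, X_n) ∈ π_n B` for `n ≥ 1`, and `1` for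
`n = 0`, as the root is always retained. -/
def levelProb {N : ℕ∞} (μ : Measure ℝ) (B : Set (RPow N)) (n : ℕ) : ℝ≥0∞ :=
  if n = 0 then 1 else Measure.pi (fun _ : Fin n => μ) (projSet B n)

/-- The function `Ψ(B; a₁, …, a_n)` (with `a i` standing for `a_{i+1}`), for `X` of law `μ`:
`Ψ(B; a) = P(X ∉ B)^a` for `n = 1`, and `Ψ(B; a₁, …, a_n) = (E Ψ(B/X; a₂, …, a_n))^{a₁}` for
`n ≥ 2`, where `B/x` is the cross-section of `B` at `x`. For a tree of height `0` the only ray is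
the root, which is always retained, and the value is `0`. -/
def virtualDisc (μ : Measure ℝ) : ∀ n : ℕ, Set (Fin n → ℝ) → (ℕ → ℝ) → ℝ≥0∞
  | 0, _, _ => 0
  | 1, B, a => (μ {x : ℝ | (fun _ : Fin 1 => x) ∉ B}) ^ (a 0)
  | n + 2, B, a =>
      (∫⁻ x : ℝ, virtualDisc μ (n + 1) {y : Fin (n + 1) → ℝ | (Fin.cons x y : Fin (n + 2) → ℝ) ∈ B}
        (fun i => a (i + 1)) ∂μ) ^ (a 0)

/-- The probability `P(B; ρ ↔ ∂Λ)` for the (virtual) spherically symmetric tree `Λ` of height `N`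
with growth numbers `f 0, f 1, …`: it is `1 - Ψ(B; f)` for `N < ∞`, and for `N = ∞` the limit as
`n → ∞` of the probabilities for the first `n` levels. (These decrease in `n`, so they converge, and
the `limsup` below is their limit.) -/
def virtualConn {N : ℕ∞} (μ : Measure ℝ) (B : Set (RPow N)) (f : ℕ → ℝ) : ℝ≥0∞ :=
  if N = ⊤ then Filter.limsup (fun n : ℕ => 1 - virtualDisc μ n (projSet B n) f) Filter.atTop
  else 1 - virtualDisc μ N.toNat (projSet B N.toNat) f

/-- The Cartesian product target set `{y ∈ ℝ^N : y_i ≤ b_i for all finite i ≤ N}`. -/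
def productTarget (N : ℕ∞) (b : ℕ → EReal) : Set (RPow N) :=
  {y | ∀ i : {i : ℕ // (i : ℕ∞) < N}, ((y i : ℝ) : EReal) ≤ b i}

/-- The thresholds `b` are such that, for labels of law `ν`, the product target set has the level
probabilities `p`: `∏_{i ≤ n} P(Y ≤ b_i) = p n` for every finite `n ≤ N`. -/
def MatchesLevels (N : ℕ∞) (ν : Measure ℝ) (p : ℕ → ℝ≥0∞) (b : ℕ → EReal) : Prop :=
  ∀ n : ℕ, (n : ℕ∞) ≤ N → ∏ i ∈ Finset.range n, ν {x : ℝ | (x : EReal) ≤ b i} = p n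

/-- The quantity
`2 [p(N)⁻¹ |Γ_N|⁻¹ + ∑_{0 ≤ k < N} p(k)⁻¹ (|Γ_k|⁻¹ - |Γ_{k+1}|⁻¹)]⁻¹`,
where the first term in the bracket is present only if `N < ∞`; computed in `[0, ∞]` with
`0⁻¹ = ∞`, `∞⁻¹ = 0`, `∞ · 0 = 0`. -/
def resistanceBound {N : ℕ∞} (Γ : LevelTree.{u} N) (p : ℕ → ℝ≥0∞) : ℝ≥0∞ :=
  2 * ((if N = ⊤ then 0 else (p N.toNat)⁻¹ * (Γ.card N.toNat : ℝ≥0∞)⁻¹) +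
    ∑' k : {k : ℕ // (k : ℕ∞) < N},
      (p k)⁻¹ * ((Γ.card k : ℝ≥0∞)⁻¹ - (Γ.card (k + 1) : ℝ≥0∞)⁻¹))⁻¹

end

/-! First inequality. Let `A` be a measurable version of π_n B, and reveal the labels one generation
at a time. For 0 ≤ k ≤ n consider E ∏_{σ ∈ Γ_k} Ψ(A/σ; f_σ), where A/σ is the section of `A` at the
labels on the path to σ and f_σ lists the ratios of successive generation sizes among the
descendants of σ. At k = 0 this is Ψ(A; f) for the symmetrized tree; at k = n it is the probability
that no vertex of Γ_n has its labels in `A`. It is nondecreasing in k: by Hölder, pooling the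
subtrees below the children of a vertex can only lower Ψ (`disc_ratio_sum_le`,
`disc_descendants_le`), and the labels of the next generation are independent of the past
(`disc_growth_le_lintegral`).

Second inequality. For a product target, Ψ is an explicit function `levelDisc` of the level
probabilities. It is homogeneous of degree one and, by Jensen for the perspective of t ↦ t^f with f
≥ 1, convex (`levelDisc_lintegral_le`). The level probabilities of `B` are averages, over the first
label, of those of its sections, so induction on the dimension shows that Ψ is at least `levelDisc`
(`levelDisc_le_disc`).

Third inequality. For product targets the bound is proved by induction on the height. Adding one
level at the root preserves the constant 2 because of the elementary inequality (1 - (1 - y)^f)((1 -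
1/f) + 2/(f y)) ≤ 2 (`one_sub_rpow_mul_le`, `one_sub_productDisc_mul_le`).

Capacity. Writing 1/p(|ξ ∧ η|) as a sum of increments of 1/p over the common levels turns the energy
of m into ∑_j (increment of 1/p at j) · ∑_{|σ| = j} m(σ)². Cauchy–Schwarz bounds each inner sum
below by 1/|Γ_j|, and the uniform measure attains all these bounds at once. Summation by parts
identifies the result with the bracket in R.

Projections of a closed set are analytic, hence universally measurable; this allows them to be
replaced by measurable sets throughout. -/

noncomputable section

/-! ### Universal measurability of analytic sets -/

/-- The coordinates are bounded one at a time. The images need not be measurable, but a measure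
extended to all sets is still continuous along increasing sequences of sets, so each new bound can
be chosen large enough to keep the value above `c`. -/
theorem exists_bounds_of_lt_measure_image {α : Type*} [MeasurableSpace α] (μ : Measure α)
    (f : (ℕ → ℕ) → α) {c : ℝ≥0∞} (hc : c < μ (Set.range f)) :
    ∃ g : ℕ → ℕ, ∀ k, c < μ (f '' {x | ∀ i < k, x i ≤ g i}) := by
  have step : ∀ (k : ℕ) (h : ℕ → ℕ), c < μ (f '' {x | ∀ i < k, x i ≤ h i}) →
      ∃ m, c < μ (f '' {x | ∀ i < k + 1, x i ≤ Function.update h k m i}) := by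
    intro k h hk
    have hU : f '' {x | ∀ i < k, x i ≤ h i} ⊆
        ⋃ m, f '' {x | (∀ i < k, x i ≤ h i) ∧ x k ≤ m} := by
      rintro _ ⟨x, hx, rfl⟩
      exact Set.mem_iUnion.2 ⟨x k, x, ⟨hx, le_rfl⟩, rfl⟩
    have hdir : Directed (· ⊆ ·) fun m : ℕ => f '' {x | (∀ i < k, x i ≤ h i) ∧ x k ≤ m} := by
      refine directed_of_isDirected_le fun m m' hmm => Set.image_mono ?_
      exact fun x hx => ⟨hx.1, hx.2.trans hmm⟩
    have h1 := hk.trans_le (measure_mono hU)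
    rw [hdir.measure_iUnion] at h1
    obtain ⟨m, hm⟩ := lt_iSup_iff.1 h1
    refine ⟨m, hm.trans_le (measure_mono (Set.image_mono ?_))⟩
    rintro x ⟨hx1, hx2⟩ i hi
    rcases Nat.lt_succ_iff_lt_or_eq.1 hi with h' | rfl
    · rw [Function.update_of_ne h'.ne]; exact hx1 i h'
    · simpa using hx2
  choose! m hm using step
  -- Stage k + 1 changes only coordinate k, so coordinate i is frozen from stage i + 1 on and the
  -- stages have a well-defined diagonal limit.
  let G : ∀ k : ℕ, {h : ℕ → ℕ // c < μ (f '' {x | ∀ i < k, x i ≤ h i})} := fun k =>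
    Nat.rec ⟨fun _ => 0, by simpa using hc⟩
      (fun k h => ⟨Function.update h.1 k (m k h.1), hm k h.1 h.2⟩) k
  have hG : ∀ k, (G (k + 1)).1 = Function.update (G k).1 k (m k (G k).1) := fun k => rfl
  have hG' : ∀ k i, i < k → (G k).1 i = (G (i + 1)).1 i := by
    intro k i hi
    induction k with
    | zero => omega
    | succ k ih =>
      rcases Nat.lt_succ_iff_lt_or_eq.1 hi with h' | rfl
      · rw [hG, Function.update_of_ne h'.ne, ih h']
      · rfl
  refine ⟨fun i => (G (i + 1)).1 i, fun k => ?_⟩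
  have h := (G k).2
  have hset : {x : ℕ → ℕ | ∀ i < k, x i ≤ (G (i + 1)).1 i} = {x | ∀ i < k, x i ≤ (G k).1 i} := by
    ext x
    exact forall₂_congr fun i hi => by rw [hG' k i hi]
  rwa [← hset] at h

/-- The box cut out by `g` is compact, so its image is closed. A point off this image has a closed
neighbourhood missing it, and by compactness that neighbourhood already misses the image of some box
with only finitely many coordinates bounded. -/
theorem iInter_closure_image_subset {α : Type*} [TopologicalSpace α] [T2Space α] [RegularSpace α]
    {f : (ℕ → ℕ) → α} (hf : Continuous f) (g : ℕ → ℕ) :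
    ⋂ k, closure (f '' {x | ∀ i < k, x i ≤ g i}) ⊆ f '' {x | ∀ i, x i ≤ g i} := by
  have hK : IsCompact {x : ℕ → ℕ | ∀ i, x i ≤ g i} := by
    have : {x : ℕ → ℕ | ∀ i, x i ≤ g i} = Set.univ.pi fun i => Set.Iic (g i) := by
      ext x; simp [Pi.le_def]
    rw [this]
    exact isCompact_univ_pi fun i => (Set.finite_Iic (g i)).isCompact
  intro y hy
  by_contra hyK
  have hcl : IsClosed (f '' {x | ∀ i, x i ≤ g i}) := (hK.image hf).isClosed
  obtain ⟨V, ⟨hV, hVc⟩, hVK⟩ := (closed_nhds_basis y).mem_iff.1 (hcl.isOpen_compl.mem_nhds hyK)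
  have hUo : IsOpen (f ⁻¹' Vᶜ) := hVc.isOpen_compl.preimage hf
  have key : ∃ k, {x : ℕ → ℕ | ∀ i < k, x i ≤ g i} ⊆ f ⁻¹' Vᶜ := by
    by_contra hcon
    push Not at hcon
    simp only [Set.not_subset] at hcon
    choose x hx hxV using hcon
    -- Truncating by `g` puts the sequence in the compact box. Coordinate i is unaffected once the
    -- index exceeds i, so the original sequence converges along the same subsequence.
    obtain ⟨z, hz, φ, hφ, hlim⟩ := hK.tendsto_subseq (x := fun k i => min (x k i) (g i))
      (fun k i => min_le_right _ _)
    have hlim' : Filter.Tendsto (x ∘ φ) Filter.atTop (nhds z) := by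
      rw [tendsto_pi_nhds] at hlim ⊢
      intro i
      refine (hlim i).congr' ?_
      filter_upwards [Filter.eventually_gt_atTop i] with k hk
      exact min_eq_left (hx (φ k) i (hk.trans_le (hφ.le_apply)))
    have hzU : z ∈ f ⁻¹' Vᶜ := fun h => hVK h ⟨z, hz, rfl⟩
    obtain ⟨k, hk⟩ := (hlim'.eventually (hUo.mem_nhds hzU)).exists
    exact hxV _ hk
  obtain ⟨k, hk⟩ := key
  have h1 := mem_closure_iff_nhds.1 (Set.mem_iInter.1 hy k) V hV
  obtain ⟨_, hz, x, hx, rfl⟩ := h1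
  exact hk hx hz

/-- Choquet capacitability: the closures of the images of the partial boxes decrease to a closed
subset of `A`, and continuity from above preserves the lower bound `c`. -/
theorem MeasureTheory.AnalyticSet.exists_measurableSet_subset_lt_measure {α : Type*}
    [TopologicalSpace α] [T2Space α] [RegularSpace α] [MeasurableSpace α] [OpensMeasurableSpace α]
    {A : Set α} (hA : AnalyticSet A) (μ : Measure α) [IsFiniteMeasure μ] {c : ℝ≥0∞}
    (hc : c < μ A) : ∃ K ⊆ A, MeasurableSet K ∧ c ≤ μ K := by
  rw [AnalyticSet] at hA
  rcases hA with rfl | ⟨f, hf, rfl⟩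
  · simp at hc
  obtain ⟨g, hg⟩ := exists_bounds_of_lt_measure_image μ f hc
  have hmeas : ∀ k, MeasurableSet (closure (f '' {x | ∀ i < k, x i ≤ g i})) :=
    fun k => isClosed_closure.measurableSet
  refine ⟨⋂ k, closure (f '' {x | ∀ i < k, x i ≤ g i}),
    (iInter_closure_image_subset hf g).trans (Set.image_subset_range _ _),
    MeasurableSet.iInter hmeas, ?_⟩
  have hanti : Antitone fun k => closure (f '' {x | ∀ i < k, x i ≤ g i}) := fun k l hkl =>
    closure_mono (Set.image_mono fun x hx i hi => hx i (hi.trans_le hkl))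
  rw [hanti.measure_iInter (fun k => (hmeas k).nullMeasurableSet) ⟨0, measure_ne_top _ _⟩]
  exact le_iInf fun k => (hg k).le.trans (measure_mono subset_closure)

/-- Countably many inner approximations fill up the measure of `A`, so their union differs from the
measurable hull of `A` by a null set, and `A` lies between the two. -/
theorem MeasureTheory.AnalyticSet.nullMeasurableSet {α : Type*}
    [TopologicalSpace α] [T2Space α] [RegularSpace α] [MeasurableSpace α] [OpensMeasurableSpace α]
    {A : Set α} (hA : AnalyticSet A) (μ : Measure α) [IsFiniteMeasure μ] :
    NullMeasurableSet A μ := by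
  rcases eq_or_ne (μ A) 0 with h0 | h0
  · exact NullMeasurableSet.of_null h0
  obtain ⟨u, -, hu, hlim⟩ := exists_seq_strictMono_tendsto' (pos_iff_ne_zero.2 h0)
  choose K hKA hKm hK using fun n =>
    hA.exists_measurableSet_subset_lt_measure μ (hu n).2
  have hF : MeasurableSet (⋃ n, K n) := MeasurableSet.iUnion hKm
  have hFA : ⋃ n, K n ⊆ A := Set.iUnion_subset hKA
  have hle : μ A ≤ μ (⋃ n, K n) :=
    le_of_tendsto' hlim fun n => (hK n).trans (measure_mono (Set.subset_iUnion _ _))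
  have h1 : (⋃ n, K n) =ᵐ[μ] toMeasurable μ A :=
    ae_eq_of_subset_of_measure_ge (hFA.trans (subset_toMeasurable _ _))
      (by rw [measure_toMeasurable]; exact hle) hF.nullMeasurableSet (measure_ne_top _ _)
  refine hF.nullMeasurableSet.congr
    (Filter.EventuallyLE.antisymm (LE.le.eventuallyLE hFA) ?_)
  exact (LE.le.eventuallyLE (subset_toMeasurable μ A)).trans h1.symm.le

/-! ### Projections of the target set -/

theorem projSet_eq_image {N : ℕ∞} (B : Set (RPow N)) {k : ℕ} (hk : (k : ℕ∞) ≤ N) :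
    projSet B k = (fun (y : RPow N) (i : Fin k) =>
      y ⟨i, lt_of_lt_of_le (by exact_mod_cast i.2) hk⟩) '' B := by
  ext z
  constructor
  · rintro ⟨y, hy, h⟩
    exact ⟨y, hy, funext fun i => (h i _).symm⟩
  · rintro ⟨y, hy, rfl⟩
    exact ⟨y, hy, fun i h => rfl⟩

/-- When `N` is infinite such a projection may fail to be Borel, but as a continuous image of a
closed set it is analytic. -/
theorem nullMeasurableSet_projSet {N : ℕ∞} {B : Set (RPow N)} (hB : IsClosed B) {k : ℕ}
    (hk : (k : ℕ∞) ≤ N) (μ : Measure (Fin k → ℝ)) [IsFiniteMeasure μ] :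
    NullMeasurableSet (projSet B k) μ := by
  rw [projSet_eq_image B hk]
  exact (hB.analyticSet.image_of_continuous (by fun_prop)).nullMeasurableSet μ

theorem init_mem_projSet {N : ℕ∞} {B : Set (RPow N)} {k : ℕ} {z : Fin (k + 1) → ℝ}
    (hz : z ∈ projSet B (k + 1)) : (fun i : Fin k => z i.castSucc) ∈ projSet B k := by
  obtain ⟨y, hy, h⟩ := hz
  exact ⟨y, hy, fun i hi => h i.castSucc hi⟩

theorem measurePreserving_init (μ : Measure ℝ) [IsProbabilityMeasure μ] (k : ℕ) :
    MeasurePreserving (fun (z : Fin (k + 1) → ℝ) (i : Fin k) => z i.castSucc)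
      (Measure.pi fun _ => μ) (Measure.pi fun _ => μ) := by
  have h := (measurePreserving_piFinSuccAbove (fun _ : Fin (k + 1) => μ) (Fin.last k))
  have h2 := (measurePreserving_snd (μ := μ) (ν := Measure.pi fun _ : Fin k => μ)).comp h
  convert h2 using 1
  ext z i
  simp [MeasurableEquiv.piFinSuccAbove, Fin.insertNthEquiv, Fin.init]

theorem levelProb_zero {N : ℕ∞} (μ : Measure ℝ) (B : Set (RPow N)) : levelProb μ B 0 = 1 := by
  simp [levelProb]

theorem levelProb_le_one {N : ℕ∞} (μ : Measure ℝ) [IsProbabilityMeasure μ] (B : Set (RPow N))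
    (n : ℕ) : levelProb μ B n ≤ 1 := by
  unfold levelProb
  split_ifs
  exacts [le_rfl, prob_le_one]

theorem levelProb_antitone {N : ℕ∞} (μ : Measure ℝ) [IsProbabilityMeasure μ] (B : Set (RPow N)) :
    Antitone (levelProb μ B) := by
  refine antitone_nat_of_succ_le fun n => ?_
  rcases Nat.eq_zero_or_pos n with rfl | hn
  · rw [levelProb_zero]; exact levelProb_le_one _ _ _
  rw [levelProb, levelProb, if_neg (by omega), if_neg (by omega),
    -- Passing to the measurable hull makes the preimage formula applicable without any assumption
    -- on `B`.
    ← measure_toMeasurable (projSet B n),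
    ← (measurePreserving_init μ n).measure_preimage
      (measurableSet_toMeasurable _ _).nullMeasurableSet]
  exact measure_mono fun z hz => subset_toMeasurable _ _ (init_mem_projSet hz)

/-! ### The disconnection function -/

/-- The disconnection function `Ψ(A; a)` with base case the indicator of `A = ∅` in dimension `0`.
It agrees with `virtualDisc` in positive dimensions on measurable sets. -/
def disc (μ : Measure ℝ) : ∀ n : ℕ, Set (Fin n → ℝ) → (ℕ → ℝ) → ℝ≥0∞
  | 0, A, _ => Set.indicator Aᶜ (fun _ => 1) Fin.elim0
  | n + 1, A, a =>
      (∫⁻ x : ℝ, disc μ n {y | (Fin.cons x y : Fin (n + 1) → ℝ) ∈ A}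
        (fun i => a (i + 1)) ∂μ) ^ (a 0)

section Disc

variable (μ : Measure ℝ)

theorem disc_zero_of_mem {A : Set (Fin 0 → ℝ)} (h : Fin.elim0 ∈ A) (a : ℕ → ℝ) :
    disc μ 0 A a = 0 := by
  simp [disc, h]

theorem disc_zero_of_notMem {A : Set (Fin 0 → ℝ)} (h : Fin.elim0 ∉ A) (a : ℕ → ℝ) :
    disc μ 0 A a = 1 := by
  simp [disc, h]

theorem disc_succ (n : ℕ) (A : Set (Fin (n + 1) → ℝ)) (a : ℕ → ℝ) :
    disc μ (n + 1) A a =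
      (∫⁻ x : ℝ, disc μ n {y | (Fin.cons x y : Fin (n + 1) → ℝ) ∈ A}
        (fun i => a (i + 1)) ∂μ) ^ (a 0) :=
  rfl

theorem disc_empty [IsProbabilityMeasure μ] (n : ℕ) (a : ℕ → ℝ) : disc μ n ∅ a = 1 := by
  induction n generalizing a with
  | zero => exact disc_zero_of_notMem _ (by simp) _
  | succ n ih => simp [disc_succ, ih]

theorem measurable_cons (n : ℕ) :
    Measurable fun p : ℝ × (Fin n → ℝ) => (Fin.cons p.1 p.2 : Fin (n + 1) → ℝ) := by
  refine measurable_pi_iff.2 fun i => ?_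
  refine Fin.cases ?_ (fun i => ?_) i
  · simpa using measurable_fst
  · simp only [Fin.cons_succ]; fun_prop

theorem measurableSet_section {n : ℕ} {A : Set (Fin (n + 1) → ℝ)} (hA : MeasurableSet A) (x : ℝ) :
    MeasurableSet {y : Fin n → ℝ | (Fin.cons x y : Fin (n + 1) → ℝ) ∈ A} :=
  ((measurable_cons n).comp measurable_prodMk_left) hA

theorem measurable_disc [SFinite μ] {Z : Type*} [MeasurableSpace Z] (n : ℕ)
    {D : Set (Z × (Fin n → ℝ))} (hD : MeasurableSet D) (a : ℕ → ℝ) :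
    Measurable fun z => disc μ n {y | (z, y) ∈ D} a := by
  -- The parameter space must vary in the induction: the step moves the first coordinate into it,
  -- replacing `Z` by `Z × ℝ`.
  suffices H : ∀ (n : ℕ) (a : ℕ → ℝ) (Z : Type _) [MeasurableSpace Z] (D : Set (Z × (Fin n → ℝ))),
      MeasurableSet D → Measurable fun z => disc μ n {y | (z, y) ∈ D} a from H n a Z D hD
  clear hD D
  intro n
  induction n with
  | zero =>
    intro a Z _ D hD
    have : Measurable (Set.indicator ((fun z : Z => (z, (Fin.elim0 : Fin 0 → ℝ))) ⁻¹' Dᶜ)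
        fun _ => (1 : ℝ≥0∞)) :=
      measurable_const.indicator (measurable_prodMk_right hD.compl)
    exact this
  | succ n ih =>
    intro a Z _ D hD
    have hD' : MeasurableSet ((fun p : (Z × ℝ) × (Fin n → ℝ) =>
        (p.1.1, (Fin.cons p.1.2 p.2 : Fin (n + 1) → ℝ))) ⁻¹' D) :=
      ((measurable_fst.comp measurable_fst).prodMk ((measurable_cons n).comp
        ((measurable_snd.comp measurable_fst).prodMk measurable_snd))) hD
    exact ((ih (fun i => a (i + 1)) (Z × ℝ) _ hD').lintegral_prod_right').pow_const _

theorem measurable_disc_section [SFinite μ] {n : ℕ} {A : Set (Fin (n + 1) → ℝ)}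
    (hA : MeasurableSet A) (a : ℕ → ℝ) :
    Measurable fun x => disc μ n {y | (Fin.cons x y : Fin (n + 1) → ℝ) ∈ A} a :=
  measurable_disc μ n (D := (fun p : ℝ × (Fin n → ℝ) => (Fin.cons p.1 p.2 : Fin (n + 1) → ℝ)) ⁻¹' A)
    (measurable_cons n hA) a

theorem measurePreserving_cons [SigmaFinite μ] (n : ℕ) :
    MeasurePreserving (fun p : ℝ × (Fin n → ℝ) => (Fin.cons p.1 p.2 : Fin (n + 1) → ℝ))
      (μ.prod (Measure.pi fun _ => μ)) (Measure.pi fun _ => μ) := by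
  have h := (measurePreserving_piFinSuccAbove (fun _ : Fin (n + 1) => μ) 0).symm
  convert h using 1
  ext p i
  simp [MeasurableEquiv.piFinSuccAbove, Fin.insertNthEquiv]

theorem lintegral_measure_section [SigmaFinite μ] {n : ℕ} {A : Set (Fin (n + 1) → ℝ)}
    (hA : MeasurableSet A) :
    ∫⁻ x, Measure.pi (fun _ : Fin n => μ) {y | (Fin.cons x y : Fin (n + 1) → ℝ) ∈ A} ∂μ =
      Measure.pi (fun _ : Fin (n + 1) => μ) A := by
  rw [← (measurePreserving_cons μ n).measure_preimage hA.nullMeasurableSet,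
    Measure.prod_apply (measurable_cons n hA)]
  rfl

theorem ae_ae_section_of_ae_eq [SigmaFinite μ] {n : ℕ} {A A' : Set (Fin (n + 1) → ℝ)}
    (h : A =ᵐ[Measure.pi fun _ => μ] A') :
    ∀ᵐ x ∂μ, {y : Fin n → ℝ | (Fin.cons x y : Fin (n + 1) → ℝ) ∈ A}
      =ᵐ[Measure.pi fun _ => μ] {y | (Fin.cons x y : Fin (n + 1) → ℝ) ∈ A'} :=
  Measure.ae_ae_of_ae_prod ((measurePreserving_cons μ n).quasiMeasurePreserving.ae h)

/-- By Fubini, almost every section of a null modification is again a null modification. This is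
what permits trading projections of `B` for measurable sets. -/
theorem virtualDisc_congr_ae [SigmaFinite μ] (n : ℕ) {A A' : Set (Fin n → ℝ)} (a : ℕ → ℝ)
    (h : A =ᵐ[Measure.pi fun _ => μ] A') : virtualDisc μ n A a = virtualDisc μ n A' a := by
  match n with
  | 0 => rfl
  | 1 =>
    rw [virtualDisc, virtualDisc]
    congr 1
    have := (measurePreserving_funUnique μ (Fin 1)).symm.quasiMeasurePreserving.ae h
    refine measure_congr ?_
    filter_upwards [this] with x hx
    exact congrArg Not hx
  | n + 2 =>
    rw [virtualDisc, virtualDisc]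
    congr 1
    refine lintegral_congr_ae ?_
    filter_upwards [ae_ae_section_of_ae_eq μ h] with x hx
    exact virtualDisc_congr_ae (n + 1) _ hx

theorem virtualDisc_eq_disc (n : ℕ) {A : Set (Fin (n + 1) → ℝ)} (hA : MeasurableSet A)
    (a : ℕ → ℝ) : virtualDisc μ (n + 1) A a = disc μ (n + 1) A a := by
  induction n generalizing a with
  | zero =>
    rw [virtualDisc, disc_succ]
    congr 1
    have hm : MeasurableSet {x : ℝ | (fun _ : Fin 1 => x) ∉ A} :=
      (measurable_pi_lambda (fun x (_ : Fin 1) => x) fun _ => measurable_id) hA.compl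
    rw [← lintegral_indicator_one hm]
    congr 1 with x
    have hx : (Fin.cons x Fin.elim0 : Fin 1 → ℝ) = fun _ => x := by
      ext i; rw [Fin.fin_one_eq_zero i, Fin.cons_zero]
    by_cases h : (fun _ : Fin 1 => x) ∈ A
    · rw [disc_zero_of_mem _ (by simpa [hx] using h)]; simp [h]
    · rw [disc_zero_of_notMem _ (by simpa [hx] using h)]; simp [h]
  | succ n ih =>
    rw [virtualDisc, disc_succ]
    congr 2 with x
    exact ih (measurableSet_section hA x) _

end Disc

/-! ### Submultiplicativity of the disconnection function -/

/-- The successive ratios of a sequence of level sizes. -/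
def ratio (W : ℕ → ℝ) (i : ℕ) : ℝ := W (i + 1) / W i

theorem disc_succ_ratio (μ : Measure ℝ) (n : ℕ) (A : Set (Fin (n + 1) → ℝ)) (W : ℕ → ℝ) :
    disc μ (n + 1) A (ratio W) =
      (∫⁻ x : ℝ, disc μ n {y | (Fin.cons x y : Fin (n + 1) → ℝ) ∈ A}
        (ratio fun j => W (j + 1)) ∂μ) ^ (W 1 / W 0) :=
  rfl

/-- Hölder with the exponents w τ / ∑ w, which add up to one, applied to the root of order ∑ w of
the pointwise bound. -/
theorem lintegral_rpow_sum_le {Z ι : Type*} [MeasurableSpace Z] (m : Measure Z) {s : Finset ι}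
    (hs : s.Nonempty) {w : ι → ℝ} (hw : ∀ τ ∈ s, 0 < w τ) {F : Z → ℝ≥0∞} {G : ι → Z → ℝ≥0∞}
    (hG : ∀ τ ∈ s, Measurable (G τ)) (h : ∀ z, F z ^ (∑ τ ∈ s, w τ) ≤ ∏ τ ∈ s, G τ z ^ w τ) :
    (∫⁻ z, F z ∂m) ^ (∑ τ ∈ s, w τ) ≤ ∏ τ ∈ s, (∫⁻ z, G τ z ∂m) ^ w τ := by
  have hpos : 0 < ∑ τ ∈ s, w τ := Finset.sum_pos hw hs
  set S := ∑ τ ∈ s, w τ with hS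
  have key : ∫⁻ z, F z ∂m ≤ ∏ τ ∈ s, (∫⁻ z, G τ z ∂m) ^ (w τ / S) := by
    refine le_trans (lintegral_mono fun z => ?_) (ENNReal.lintegral_prod_norm_pow_le s
      (fun τ hτ => (hG τ hτ).aemeasurable) ?_ fun τ hτ => (div_pos (hw τ hτ) hpos).le)
    · rw [← ENNReal.rpow_le_rpow_iff hpos, ← ENNReal.prod_rpow_of_nonneg hpos.le]
      refine (h z).trans_eq (Finset.prod_congr rfl fun τ _ => ?_)
      rw [← ENNReal.rpow_mul, div_mul_cancel₀ _ hpos.ne']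
    · rw [← Finset.sum_div, div_self hpos.ne']
  refine (ENNReal.rpow_le_rpow key hpos.le).trans_eq ?_
  rw [← ENNReal.prod_rpow_of_nonneg hpos.le]
  refine Finset.prod_congr rfl fun τ _ => ?_
  rw [← ENNReal.rpow_mul, div_mul_cancel₀ _ hpos.ne']

/-- The core of the comparison with the symmetrized tree: pooling subtrees by adding their level
sizes `W τ` can only lower the chance of disconnection. Raised to the power W(0), the first exponent
W(1)/W(0) becomes W(1), so the induction hypothesis on sections is exactly the pointwise bound that
Hölder requires. -/
theorem disc_ratio_sum_le (μ : Measure ℝ) [IsProbabilityMeasure μ] {ι : Type*} {s : Finset ι}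
    (hs : s.Nonempty) (m : ℕ) {A : Set (Fin m → ℝ)} (hA : MeasurableSet A) {W : ι → ℕ → ℝ}
    (hW : ∀ τ ∈ s, ∀ j ≤ m, 0 < W τ j) :
    disc μ m A (ratio fun j => ∑ τ ∈ s, W τ j) ^ (∑ τ ∈ s, W τ 0) ≤
      ∏ τ ∈ s, disc μ m A (ratio (W τ)) ^ W τ 0 := by
  induction m generalizing W with
  | zero =>
    by_cases h : Fin.elim0 ∈ A
    · rw [disc_zero_of_mem _ h, ENNReal.zero_rpow_of_pos
        (Finset.sum_pos (fun τ hτ => hW τ hτ 0 le_rfl) hs)]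
      exact zero_le
    · simp [disc_zero_of_notMem _ h]
  | succ m ih =>
    have hpos : ∀ j ≤ m + 1, 0 < ∑ τ ∈ s, W τ j := fun j hj =>
      Finset.sum_pos (fun τ hτ => hW τ hτ j hj) hs
    rw [disc_succ_ratio, ← ENNReal.rpow_mul, div_mul_cancel₀ _ (hpos 0 (by omega)).ne']
    refine (lintegral_rpow_sum_le μ hs (fun τ hτ => hW τ hτ 1 (by omega))
      (G := fun τ x => disc μ m {y | (Fin.cons x y : Fin (m + 1) → ℝ) ∈ A}
        (ratio fun j => W τ (j + 1)))
      (fun τ _ => measurable_disc_section μ hA _) fun x => ?_).trans_eq ?_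
    · exact ih (measurableSet_section hA x) (W := fun τ j => W τ (j + 1))
        fun τ hτ j hj => hW τ hτ (j + 1) (by omega)
    · refine Finset.prod_congr rfl fun τ hτ => ?_
      rw [disc_succ_ratio, ← ENNReal.rpow_mul, div_mul_cancel₀ _ (hW τ hτ 0 (by omega)).ne']

/-! ### Level trees -/

namespace LevelTree

variable {N : ℕ∞} (Γ : LevelTree.{u} N)

instance (n : ℕ) : Finite (Γ.level n) := Γ.finite_level n

instance (n : ℕ) : Fintype (Γ.level n) := Fintype.ofFinite _

instance (n : ℕ) : DecidableEq (Γ.level n) := Classical.decEq _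

theorem card_eq_fintype (n : ℕ) : Γ.card n = Fintype.card (Γ.level n) :=
  Nat.card_eq_fintype_card

theorem card_zero : Γ.card 0 = 1 := by
  rw [card, Nat.card_eq_one_iff_unique]
  exact ⟨⟨fun a b => (Γ.eq_root a).trans (Γ.eq_root b).symm⟩, ⟨Γ.root⟩⟩

theorem level_le {n : ℕ} (σ : Γ.level n) : (n : ℕ∞) ≤ N :=
  not_lt.1 fun h => (Γ.isEmpty_level n h).elim σ

theorem level_nonempty {n : ℕ} (hn : (n : ℕ∞) ≤ N) : Nonempty (Γ.level n) := by
  induction n with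
  | zero => exact ⟨Γ.root⟩
  | succ n ih =>
    obtain ⟨σ⟩ := ih (le_trans (by exact_mod_cast n.le_succ) hn)
    obtain ⟨τ, -⟩ := Γ.exists_child n hn σ
    exact ⟨τ⟩

theorem card_pos {n : ℕ} (hn : (n : ℕ∞) ≤ N) : 0 < Γ.card n := by
  have := Γ.level_nonempty hn
  rw [card_eq_fintype]
  exact Fintype.card_pos

theorem card_le_card_succ {n : ℕ} (hn : ((n + 1 : ℕ) : ℕ∞) ≤ N) : Γ.card n ≤ Γ.card (n + 1) :=
  Nat.card_le_card_of_surjective _ (Γ.exists_child n hn)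

theorem one_le_growth {n : ℕ} (hn : ((n + 1 : ℕ) : ℕ∞) ≤ N) : 1 ≤ Γ.growth n := by
  have h : 0 < Γ.card n := Γ.card_pos (le_trans (by exact_mod_cast n.le_succ) hn)
  rw [growth, le_div_iff₀ (by exact_mod_cast h), one_mul]
  exact_mod_cast Γ.card_le_card_succ hn

theorem growth_eq_ratio : Γ.growth = ratio fun j => (Γ.card j : ℝ) := rfl

/-- The number of descendants in generation `j` after `σ`. -/
def descendants : ℕ → ∀ k, Γ.level k → ℝ
  | 0, _, _ => 1
  | j + 1, k, σ => ∑ τ with Γ.parent k τ = σ, descendants j (k + 1) τ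

theorem sum_descendants (j k : ℕ) : ∑ σ, Γ.descendants j k σ = Γ.card (k + j) := by
  induction j generalizing k with
  | zero => simp [descendants, card_eq_fintype]
  | succ j ih =>
    simp only [descendants]
    rw [Finset.sum_fiberwise, ih, show k + 1 + j = k + (j + 1) by omega]

theorem children_nonempty {k : ℕ} (hk : ((k + 1 : ℕ) : ℕ∞) ≤ N) (σ : Γ.level k) :
    (Finset.univ.filter fun τ => Γ.parent k τ = σ).Nonempty := by
  obtain ⟨τ, hτ⟩ := Γ.exists_child k hk σ
  exact ⟨τ, by simpa using hτ⟩

theorem descendants_pos {j k : ℕ} (h : ((k + j : ℕ) : ℕ∞) ≤ N) (σ : Γ.level k) :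
    0 < Γ.descendants j k σ := by
  induction j generalizing k with
  | zero => exact one_pos
  | succ j ih =>
    refine Finset.sum_pos (fun τ _ => ih (by rwa [show k + 1 + j = k + (j + 1) by omega]) τ)
      (Γ.children_nonempty (le_trans (by norm_cast; omega) h) σ)

theorem growth_eq_ratio_descendants :
    Γ.growth = ratio fun j => Γ.descendants j 0 Γ.root := by
  rw [growth_eq_ratio]
  congr 1 with j
  have : Unique (Γ.level 0) := ⟨⟨Γ.root⟩, Γ.eq_root⟩
  have h := Γ.sum_descendants j 0
  rw [Fintype.sum_unique, zero_add] at h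
  rw [← h]
  congr 1
  exact Γ.eq_root _

/-- Pooling is undone at a single vertex: on the left the subtrees below the children of σ are
pooled, on the right each child keeps its own. Every child has weight `descendants 0` = 1, so Hölder
leaves plain integrals. -/
theorem disc_descendants_le (μ : Measure ℝ) [IsProbabilityMeasure μ] {k m : ℕ}
    (h : ((k + (m + 1) : ℕ) : ℕ∞) ≤ N) (σ : Γ.level k) {A : Set (Fin (m + 1) → ℝ)}
    (hA : MeasurableSet A) :
    disc μ (m + 1) A (ratio fun j => Γ.descendants j k σ) ≤
      ∏ τ with Γ.parent k τ = σ, ∫⁻ x, disc μ m {y | (Fin.cons x y : Fin (m + 1) → ℝ) ∈ A}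
        (ratio fun j => Γ.descendants j (k + 1) τ) ∂μ := by
  have h1 := lintegral_rpow_sum_le μ
    (Γ.children_nonempty (le_trans (by norm_cast; omega) h) σ)
    (w := fun τ => Γ.descendants 0 (k + 1) τ) (fun τ _ => one_pos)
    (G := fun τ x => disc μ m {y | (Fin.cons x y : Fin (m + 1) → ℝ) ∈ A}
        (ratio fun j => Γ.descendants j (k + 1) τ))
    (fun τ _ => measurable_disc_section μ hA _)
    (fun x => disc_ratio_sum_le μ (Γ.children_nonempty (le_trans (by norm_cast; omega) h) σ) m
      (measurableSet_section hA x) (W := fun τ j => Γ.descendants j (k + 1) τ)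
      fun τ _ j hj => Γ.descendants_pos (le_trans (by norm_cast; omega) h) τ)
  rw [disc_succ_ratio]
  simpa [descendants] using h1

/-! ### Target percolation events -/

theorem inW_parent {B : Set (RPow N)} {x : Γ.NonRoot → ℝ} {k : ℕ} {σ : Γ.level (k + 1)}
    (h : Γ.InW B x (k + 1) σ) : Γ.InW B x k (Γ.parent k σ) := by
  right
  have h1 := init_mem_projSet (h.resolve_left k.succ_ne_zero)
  simpa [labels] using h1

theorem connVertex_iff (B : Set (RPow N)) (x : Γ.NonRoot → ℝ) (k : ℕ) (σ : Γ.level k) :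
    Γ.ConnVertex B x k σ ↔ Γ.InW B x k σ := by
  induction k with
  | zero => rfl
  | succ k ih =>
    rw [ConnVertex, ih]
    exact ⟨fun h => h.2, fun h => ⟨Γ.inW_parent h, h⟩⟩

/-- The vertices of the path from the root to `σ`, the root excluded. -/
def path : ∀ k : ℕ, Γ.level k → Fin k → Γ.NonRoot
  | 0, _ => Fin.elim0
  | k + 1, σ => Fin.snoc (path k (Γ.parent k σ)) ⟨k, σ⟩

theorem path_fst (k : ℕ) (σ : Γ.level k) (i : Fin k) : (Γ.path k σ i).1 = i := by
  induction k with
  | zero => exact i.elim0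
  | succ k ih =>
    refine Fin.lastCases ?_ (fun i => ?_) i
    · simp [path]
    · simp [path, ih]

theorem path_injective (k : ℕ) (σ : Γ.level k) : Function.Injective (Γ.path k σ) := by
  intro i j hij
  have := congrArg Sigma.fst hij
  rw [path_fst, path_fst] at this
  exact Fin.ext this

theorem labels_apply (x : Γ.NonRoot → ℝ) (k : ℕ) (σ : Γ.level k) (i : Fin k) :
    Γ.labels x k σ i = x (Γ.path k σ i) := by
  induction k with
  | zero => exact i.elim0
  | succ k ih =>
    refine Fin.lastCases ?_ (fun i => ?_) i
    · simp [path, labels]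
    · simp [path, labels, ih]

theorem measurable_labels {Ω : Type*} {m : MeasurableSpace Ω} {X : Γ.NonRoot → Ω → ℝ} {k : ℕ}
    (hX : ∀ τ : Γ.NonRoot, τ.1 < k → Measurable (X τ)) (σ : Γ.level k) :
    Measurable fun ω => Γ.labels (fun τ => X τ ω) k σ := by
  refine measurable_pi_iff.2 fun i => ?_
  simp only [labels_apply]
  exact hX _ (by rw [path_fst]; exact i.2)

variable {Ω : Type*} [MeasurableSpace Ω] {P : Measure Ω}
  {X : Γ.NonRoot → Ω → ℝ} {μ : Measure ℝ}

theorem map_labels [IsProbabilityMeasure P] (hX : ∀ σ, Measurable (X σ))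
    (hlaw : ∀ σ, P.map (X σ) = μ) (hindep : iIndepFun X P) (k : ℕ) (σ : Γ.level k) :
    P.map (fun ω => Γ.labels (fun τ => X τ ω) k σ) = Measure.pi fun _ => μ := by
  have h := (iIndepFun_iff_map_fun_eq_pi_map fun i => (hX (Γ.path k σ i)).aemeasurable).1
    (hindep.precomp (Γ.path_injective k σ))
  simp only [hlaw] at h
  rw [← h]
  congr 1 with ω i
  exact Γ.labels_apply _ _ _ _

theorem measure_connVertex [IsProbabilityMeasure P] [IsProbabilityMeasure μ]
    (hX : ∀ σ, Measurable (X σ)) (hlaw : ∀ σ, P.map (X σ) = μ) (hindep : iIndepFun X P)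
    {B : Set (RPow N)} (hB : IsClosed B) (n : ℕ) (σ : Γ.level n) :
    P {ω | Γ.ConnVertex B (fun τ => X τ ω) n σ} = levelProb μ B n := by
  simp only [connVertex_iff, InW, levelProb]
  split_ifs with h
  · simp [h]
  · simp only [h, false_or]
    rw [← Γ.map_labels hX hlaw hindep n σ, Measure.map_apply₀
      (Γ.measurable_labels (fun τ _ => hX τ) σ).aemeasurable]
    · rfl
    · rw [Γ.map_labels hX hlaw hindep n σ]
      exact nullMeasurableSet_projSet hB (Γ.level_le σ) _

theorem indepFun_labels (hX : ∀ σ, Measurable (X σ)) (hindep : iIndepFun X P) (k : ℕ) :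
    IndepFun (fun ω (σ : Γ.level k) => Γ.labels (fun τ => X τ ω) k σ)
      (fun ω (τ : Γ.level (k + 1)) => X ⟨k, τ⟩ ω) P := by
  -- A non-root vertex with index n lies in level n + 1, so the two families are the labels of
  -- levels 1, …, k and those of level k + 1.
  have hdisj : Disjoint {τ : Γ.NonRoot | τ.1 < k} {τ | τ.1 = k} :=
    Set.disjoint_left.2 fun τ h h' => (Nat.lt_irrefl _ (h'.subst (motive := fun j => j < k) h))
  have h := indep_iSup_of_disjoint (fun τ => (hX τ).comap_le) hindep.iIndep hdisj
  rw [IndepFun_iff_Indep]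
  refine indep_of_indep_of_le_left (indep_of_indep_of_le_right h ?_) ?_
  · rw [← measurable_iff_comap_le]
    refine (@measurable_pi_iff _ _ _ (_) _ _).2 fun τ => ?_
    exact (comap_measurable (X ⟨k, τ⟩)).mono
      (le_iSup₂_of_le (f := fun (i : Γ.NonRoot) (_ : i ∈ {τ : Γ.NonRoot | τ.1 = k}) =>
        MeasurableSpace.comap (X i) inferInstance) ⟨k, τ⟩ rfl le_rfl) le_rfl
  · rw [← measurable_iff_comap_le]
    refine (@measurable_pi_iff _ _ _ (_) _ _).2 fun σ => Γ.measurable_labels (fun τ hτ => ?_) σ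
    exact (comap_measurable (X τ)).mono
      (le_iSup₂_of_le (f := fun (i : Γ.NonRoot) (_ : i ∈ {τ : Γ.NonRoot | τ.1 < k}) =>
        MeasurableSpace.comap (X i) inferInstance) τ hτ le_rfl) le_rfl

end LevelTree

/-! ### Comparison of a tree with its spherical symmetrization -/

/-- The cross-section of `A` at a vector of first `k` coordinates. -/
def prefixSection {n : ℕ} (A : Set (Fin n → ℝ)) (k m : ℕ) (h : k + m = n) (v : Fin k → ℝ) :
    Set (Fin m → ℝ) :=
  {y | (fun i : Fin n => if hi : (i : ℕ) < k then v ⟨i, hi⟩ else y ⟨i - k, by omega⟩) ∈ A}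

theorem prefixSection_zero {n : ℕ} (A : Set (Fin n → ℝ)) (v : Fin 0 → ℝ) :
    prefixSection A 0 n (zero_add n) v = A := by
  ext y
  simp [prefixSection]

theorem mem_prefixSection_self {n : ℕ} (A : Set (Fin n → ℝ)) (v : Fin n → ℝ) (y : Fin 0 → ℝ) :
    y ∈ prefixSection A n 0 (add_zero n) v ↔ v ∈ A := by
  simp [prefixSection]

theorem cons_mem_prefixSection {n : ℕ} (A : Set (Fin n → ℝ)) {k m : ℕ} (h : k + (m + 1) = n)
    (v : Fin k → ℝ) (x : ℝ) (y : Fin m → ℝ) :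
    (Fin.cons x y : Fin (m + 1) → ℝ) ∈ prefixSection A k (m + 1) h v ↔
      y ∈ prefixSection A (k + 1) m (by omega) (Fin.snoc v x) := by
  simp only [prefixSection, Set.mem_ofPred_eq]
  refine iff_of_eq (congrArg (· ∈ A) (funext fun i => ?_))
  rcases lt_trichotomy (i : ℕ) k with hi | hi | hi
  · have hi' : (i : ℕ) < k + 1 := by omega
    simp [hi, hi', Fin.snoc]
  · have h1 : (⟨(i : ℕ) - k, by omega⟩ : Fin (m + 1)) = 0 := Fin.ext (by simp [hi])
    simp [hi, Fin.snoc]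
  · obtain ⟨d, hd⟩ : ∃ d, (i : ℕ) = k + 1 + d := ⟨i - (k + 1), by omega⟩
    have h1 : (⟨(i : ℕ) - k, by omega⟩ : Fin (m + 1)) = Fin.succ ⟨i - (k + 1), by omega⟩ :=
      Fin.ext (by simp; omega)
    have h2 : ¬ (i : ℕ) < k := by omega
    have h3 : ¬ (i : ℕ) < k + 1 := by omega
    simp only [dif_neg h2, dif_neg h3, h1, Fin.cons_succ]

theorem measurableSet_prefixSection_prod {n : ℕ} {A : Set (Fin n → ℝ)} (hA : MeasurableSet A)
    {k m : ℕ} (h : k + m = n) :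
    MeasurableSet {p : (Fin k → ℝ) × (Fin m → ℝ) | p.2 ∈ prefixSection A k m h p.1} := by
  have : Measurable fun (p : (Fin k → ℝ) × (Fin m → ℝ)) (i : Fin n) =>
      if hi : (i : ℕ) < k then p.1 ⟨i, hi⟩ else p.2 ⟨i - k, by omega⟩ := by
    refine measurable_pi_iff.2 fun i => ?_
    split_ifs <;> fun_prop
  exact this hA

theorem measurableSet_prefixSection {n : ℕ} {A : Set (Fin n → ℝ)} (hA : MeasurableSet A)
    {k m : ℕ} (h : k + m = n) (v : Fin k → ℝ) : MeasurableSet (prefixSection A k m h v) :=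
  measurable_prodMk_left (x := v) (measurableSet_prefixSection_prod hA h)

theorem measurable_disc_prefixSection (μ : Measure ℝ) [SFinite μ] {n : ℕ} {A : Set (Fin n → ℝ)}
    (hA : MeasurableSet A) {k m : ℕ} (h : k + m = n) (a : ℕ → ℝ) :
    Measurable fun v => disc μ m (prefixSection A k m h v) a :=
  measurable_disc μ m (measurableSet_prefixSection_prod hA h) a

theorem measurable_snoc (k : ℕ) :
    Measurable fun p : (Fin k → ℝ) × ℝ => (Fin.snoc p.1 p.2 : Fin (k + 1) → ℝ) := by
  refine measurable_pi_iff.2 fun i => ?_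
  refine Fin.lastCases ?_ (fun i => ?_) i
  · simpa using measurable_snd
  · simp only [Fin.snoc_castSucc]; fun_prop

theorem lintegral_pi_prod {ι : Type*} [Fintype ι] (μ : Measure ℝ) [IsProbabilityMeasure μ]
    {F : ι → ℝ → ℝ≥0∞} (hF : ∀ i, Measurable (F i)) :
    ∫⁻ x, ∏ i, F i (x i) ∂(Measure.pi fun _ => μ) = ∏ i, ∫⁻ t, F i t ∂μ := by
  have hind : iIndepFun (fun (i : ι) (x : ι → ℝ) => F i (x i)) (Measure.pi fun _ => μ) :=
    iIndepFun_pi fun i => (hF i).aemeasurable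
  rw [lintegral_prod_eq_prod_lintegral_of_indepFun Finset.univ _ hind
    fun i => (hF i).comp (measurable_pi_apply i)]
  refine Finset.prod_congr rfl fun i _ => ?_
  exact (measurePreserving_eval (fun _ => μ) i).lintegral_comp (hF i)

namespace LevelTree

variable {N : ℕ∞} (Γ : LevelTree.{u} N)
variable {Ω : Type*} [MeasurableSpace Ω] {P : Measure Ω} [IsProbabilityMeasure P]
  {X : Γ.NonRoot → Ω → ℝ} {μ : Measure ℝ}

theorem map_labels_prodMk [IsProbabilityMeasure μ] (hX : ∀ σ, Measurable (X σ))
    (hlaw : ∀ σ, P.map (X σ) = μ) (hindep : iIndepFun X P) (k : ℕ) :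
    P.map (fun ω => ((fun σ : Γ.level k => Γ.labels (fun τ => X τ ω) k σ),
        fun τ : Γ.level (k + 1) => X ⟨k, τ⟩ ω)) =
      (P.map fun ω (σ : Γ.level k) => Γ.labels (fun τ => X τ ω) k σ).prod
        (Measure.pi fun _ => μ) := by
  rw [(indepFun_iff_map_prod_eq_prod_map_map
    (measurable_pi_iff.2 fun σ => Γ.measurable_labels (fun τ _ => hX τ) σ).aemeasurable
    (measurable_pi_iff.2 fun τ => hX ⟨k, τ⟩).aemeasurable).1 (Γ.indepFun_labels hX hindep k)]
  congr 1
  have h := (iIndepFun_iff_map_fun_eq_pi_map fun τ : Γ.level (k + 1) =>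
    (hX ⟨k, τ⟩).aemeasurable).1 (hindep.precomp sigma_mk_injective)
  simpa only [hlaw] using h

/-- Given the labels up to level k, the labels of level k + 1 are i.i.d. with law `μ`, and each
factor involves only one of them; the conditional expectation of the product is therefore the
product of the integrals. -/
theorem lintegral_prod_lintegral_labels [IsProbabilityMeasure μ] (hX : ∀ σ, Measurable (X σ))
    (hlaw : ∀ σ, P.map (X σ) = μ) (hindep : iIndepFun X P) (k : ℕ)
    {F : Γ.level (k + 1) → (Fin (k + 1) → ℝ) → ℝ≥0∞} (hF : ∀ τ, Measurable (F τ)) :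
    ∫⁻ ω, ∏ τ, ∫⁻ x, F τ (Fin.snoc (Γ.labels (fun τ => X τ ω) k (Γ.parent k τ)) x) ∂μ ∂P =
      ∫⁻ ω, ∏ τ, F τ (Γ.labels (fun τ => X τ ω) (k + 1) τ) ∂P := by
  have hU : Measurable fun ω (σ : Γ.level k) => Γ.labels (fun τ => X τ ω) k σ :=
    measurable_pi_iff.2 fun σ => Γ.measurable_labels (fun τ _ => hX τ) σ
  have hV : Measurable fun ω (τ : Γ.level (k + 1)) => X ⟨k, τ⟩ ω :=
    measurable_pi_iff.2 fun τ => hX ⟨k, τ⟩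
  have hH : Measurable fun p : (Γ.level k → Fin k → ℝ) × (Γ.level (k + 1) → ℝ) =>
      ∏ τ, F τ (Fin.snoc (p.1 (Γ.parent k τ)) (p.2 τ)) := by
    refine Finset.measurable_prod _ fun τ _ => ?_
    have h : Measurable fun p : (Γ.level k → Fin k → ℝ) × (Γ.level (k + 1) → ℝ) =>
        (p.1 (Γ.parent k τ), p.2 τ) := by fun_prop
    exact (hF τ).comp ((measurable_snoc k).comp h)
  symm
  calc ∫⁻ ω, ∏ τ, F τ (Γ.labels (fun τ => X τ ω) (k + 1) τ) ∂P
      = ∫⁻ p, ∏ τ, F τ (Fin.snoc (p.1 (Γ.parent k τ)) (p.2 τ))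
          ∂(P.map (fun ω => ((fun σ : Γ.level k => Γ.labels (fun τ => X τ ω) k σ),
            fun τ : Γ.level (k + 1) => X ⟨k, τ⟩ ω))) := by
        rw [lintegral_map hH (hU.prodMk hV)]; rfl
    _ = ∫⁻ u, ∫⁻ v, ∏ τ, F τ (Fin.snoc (u (Γ.parent k τ)) (v τ)) ∂(Measure.pi fun _ => μ)
          ∂(P.map fun ω (σ : Γ.level k) => Γ.labels (fun τ => X τ ω) k σ) := by
        rw [Γ.map_labels_prodMk hX hlaw hindep k, lintegral_prod _ hH.aemeasurable]
    _ = _ := by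
        rw [lintegral_map hH.lintegral_prod_right' hU]
        refine lintegral_congr fun ω => ?_
        exact lintegral_pi_prod μ fun τ => (hF τ).comp
          ((measurable_snoc k).comp measurable_prodMk_left)

/-- The interpolation between the symmetrized tree (k = 0) and the actual tree (k = n). Passing from
k to k + 1 splits the factor of each σ into factors for its children and then averages over their
independent labels. -/
theorem disc_growth_le_lintegral [IsProbabilityMeasure μ] (hX : ∀ σ, Measurable (X σ))
    (hlaw : ∀ σ, P.map (X σ) = μ) (hindep : iIndepFun X P) {n : ℕ} (hn : (n : ℕ∞) ≤ N)
    {A : Set (Fin n → ℝ)} (hA : MeasurableSet A) (k m : ℕ) (h : k + m = n) :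
    disc μ n A Γ.growth ≤
      ∫⁻ ω, ∏ σ, disc μ m (prefixSection A k m h (Γ.labels (fun τ => X τ ω) k σ))
        (ratio fun j => Γ.descendants j k σ) ∂P := by
  induction k generalizing m with
  | zero =>
    obtain rfl : m = n := by omega
    have : Unique (Γ.level 0) := ⟨⟨Γ.root⟩, Γ.eq_root⟩
    simp only [prefixSection_zero, Fintype.prod_unique, Γ.growth_eq_ratio_descendants]
    rw [lintegral_const, measure_univ, mul_one, Γ.eq_root default]
  | succ k ih =>
    refine (ih (m + 1) (by omega)).trans ?_
    rw [← Γ.lintegral_prod_lintegral_labels hX hlaw hindep k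
      (F := fun τ v => disc μ m (prefixSection A (k + 1) m h v)
        (ratio fun j => Γ.descendants j (k + 1) τ))
      fun τ => measurable_disc_prefixSection μ hA h _]
    refine lintegral_mono fun ω => ?_
    simp only
    rw [← Finset.prod_fiberwise Finset.univ (Γ.parent k)]
    refine Finset.prod_le_prod' fun σ _ => ?_
    refine (Γ.disc_descendants_le μ (by rwa [show k + (m + 1) = n by omega]) σ
      (measurableSet_prefixSection hA (by omega) _)).trans_eq ?_
    refine Finset.prod_congr rfl fun τ hτ => ?_
    rw [(Finset.mem_filter.1 hτ).2]
    simp only [cons_mem_prefixSection, Set.ofPred_mem_eq]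

theorem disc_growth_le_measure [IsProbabilityMeasure μ] (hX : ∀ σ, Measurable (X σ))
    (hlaw : ∀ σ, P.map (X σ) = μ) (hindep : iIndepFun X P) {n : ℕ} (hn : (n : ℕ∞) ≤ N)
    {A : Set (Fin n → ℝ)} (hA : MeasurableSet A) :
    disc μ n A Γ.growth ≤ P {ω | ∀ σ : Γ.level n, Γ.labels (fun τ => X τ ω) n σ ∉ A} := by
  refine (Γ.disc_growth_le_lintegral hX hlaw hindep hn hA n 0 (add_zero n)).trans_eq ?_
  have hm : MeasurableSet {ω | ∀ σ : Γ.level n, Γ.labels (fun τ => X τ ω) n σ ∉ A} := by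
    simp only [Set.ofPred_forall]
    exact MeasurableSet.iInter fun σ => Γ.measurable_labels (fun τ _ => hX τ) σ hA.compl
  rw [← lintegral_indicator_one hm]
  refine lintegral_congr fun ω => ?_
  by_cases h : ∀ σ : Γ.level n, Γ.labels (fun τ => X τ ω) n σ ∉ A
  · rw [Set.indicator_of_mem (by exact h)]
    refine Finset.prod_eq_one fun σ _ => disc_zero_of_notMem _ ?_ _
    rw [mem_prefixSection_self]
    exact h σ
  · rw [Set.indicator_of_notMem (by exact h)]
    push Not at h
    obtain ⟨σ, hσ⟩ := h
    refine Finset.prod_eq_zero (Finset.mem_univ σ) (disc_zero_of_mem _ ?_ _)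
    rwa [mem_prefixSection_self]

/-- A ray in `W` yields a vertex of level n whose labels lie in the hull of the projection. Only
this inclusion is used, so measurability of the ray event plays no role. -/
theorem measure_connBoundary_le [IsProbabilityMeasure μ] (hX : ∀ σ, Measurable (X σ))
    (hlaw : ∀ σ, P.map (X σ) = μ) (hindep : iIndepFun X P) {B : Set (RPow N)} (hB : IsClosed B)
    {n : ℕ} (hn : (n : ℕ∞) ≤ N) :
    P {ω | Γ.ConnBoundary B fun τ => X τ ω} ≤ 1 - virtualDisc μ n (projSet B n) Γ.growth := by
  rcases n with _ | n
  · rw [virtualDisc, tsub_zero]; exact prob_le_one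
  have hnull := nullMeasurableSet_projSet hB hn (Measure.pi fun _ => μ)
  set A := toMeasurable (Measure.pi fun _ => μ) (projSet B (n + 1)) with hAdef
  have hA : MeasurableSet A := measurableSet_toMeasurable _ _
  rw [virtualDisc_congr_ae μ (n + 1) _ hnull.toMeasurable_ae_eq.symm, virtualDisc_eq_disc μ n hA]
  refine le_trans ?_ (tsub_le_tsub_left (Γ.disc_growth_le_measure hX hlaw hindep hn hA) 1)
  have hm : MeasurableSet {ω | ∀ σ : Γ.level (n + 1), Γ.labels (fun τ => X τ ω) (n + 1) σ ∉ A} := by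
    simp only [Set.ofPred_forall]
    exact MeasurableSet.iInter fun σ => Γ.measurable_labels (fun τ _ => hX τ) σ hA.compl
  rw [← prob_compl_eq_one_sub hm]
  refine measure_mono fun ω hω => ?_
  obtain ⟨ξ, hξ⟩ := hω
  intro hcon
  exact hcon (ξ.vertex (n + 1) hn)
    (subset_toMeasurable _ _ ((hξ (n + 1) hn).resolve_left n.succ_ne_zero))

end LevelTree

/-! ### Comparison with a product target set -/

/-- The disconnection function of a product target set in terms of its level probabilities `p`,
homogenized so that `p 0` is arbitrary. -/
def levelDisc : ℕ → (ℕ → ℝ≥0∞) → (ℕ → ℝ) → ℝ≥0∞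
  | 0, _, _ => 0
  | n + 1, p, a =>
      p 0 * ((p 0 - p 1 + levelDisc n (fun k => p (k + 1)) fun i => a (i + 1)) / p 0) ^ a 0

theorem levelDisc_congr (n : ℕ) {p q : ℕ → ℝ≥0∞} (a : ℕ → ℝ) (h : ∀ k ≤ n, p k = q k) :
    levelDisc n p a = levelDisc n q a := by
  induction n generalizing p q a with
  | zero => rfl
  | succ n ih =>
    rw [levelDisc, levelDisc, h 0 (by omega), h 1 (by omega),
      ih _ fun k hk => h (k + 1) (by omega)]

theorem levelDisc_of_zero (n : ℕ) {p : ℕ → ℝ≥0∞} (a : ℕ → ℝ) (h : p 0 = 0) :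
    levelDisc n p a = 0 := by
  cases n <;> simp [levelDisc, h]

theorem measurable_levelDisc {Z : Type*} [MeasurableSpace Z] (n : ℕ) {p : ℕ → Z → ℝ≥0∞}
    (hp : ∀ k, Measurable (p k)) (a : ℕ → ℝ) :
    Measurable fun z => levelDisc n (fun k => p k z) a := by
  induction n generalizing p a with
  | zero => exact measurable_const
  | succ n ih =>
    exact (hp 0).mul (((((hp 0).sub (hp 1)).add
      (ih (p := fun k => p (k + 1)) (fun k => hp (k + 1)) _)).div (hp 0)).pow_const _)

/-- Jensen's inequality for the perspective of the convex function `t ↦ t ^ f`. -/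
theorem lintegral_perspective_rpow_le {Z : Type*} [MeasurableSpace Z] (m : Measure Z)
    {c w : Z → ℝ≥0∞} (hc : Measurable c) (hw : Measurable w) (hc1 : ∀ z, c z ≠ ⊤)
    (hC : ∫⁻ z, c z ∂m ≠ ⊤) (hcw : ∀ z, c z = 0 → w z = 0) {f : ℝ} (hf : 1 ≤ f) :
    (∫⁻ z, c z ∂m) * ((∫⁻ z, w z ∂m) / ∫⁻ z, c z ∂m) ^ f ≤ ∫⁻ z, c z * (w z / c z) ^ f ∂m := by
  have hf0 : 0 < f := by linarith
  set C := ∫⁻ z, c z ∂m with hCdef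
  rcases eq_or_ne C 0 with h0 | h0
  · simp [h0]
  set I := ∫⁻ z, c z * (w z / c z) ^ f ∂m with hI
  -- Hölder with exponents 1 - 1/f and 1/f, applied to the factorization w = c^(1 - 1/f) · (c
  -- (w/c)^f)^(1/f).
  have hW : ∫⁻ z, w z ∂m ≤ C ^ (1 - 1 / f) * I ^ (1 / f) := by
    refine le_trans (lintegral_mono fun z => ?_) (ENNReal.lintegral_mul_norm_pow_le
      (f := c) (g := fun z => c z * (w z / c z) ^ f) hc.aemeasurable
      (hc.mul ((hw.div hc).pow_const f)).aemeasurable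
      (by rw [sub_nonneg, div_le_one hf0]; exact hf) (by positivity) (by ring))
    simp only
    rcases eq_or_ne (c z) 0 with hz | hz
    · rw [hcw z hz]; exact zero_le
    · rw [ENNReal.mul_rpow_of_nonneg _ _ (by positivity), ← mul_assoc,
        ← ENNReal.rpow_add _ _ hz (hc1 z), ← ENNReal.rpow_mul, mul_one_div_cancel hf0.ne',
        sub_add_cancel, ENNReal.rpow_one, ENNReal.rpow_one, ENNReal.mul_div_cancel hz (hc1 z)]
  have hWf : (∫⁻ z, w z ∂m) ^ f ≤ C ^ (f - 1) * I := by
    refine (ENNReal.rpow_le_rpow hW hf0.le).trans_eq ?_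
    rw [ENNReal.mul_rpow_of_nonneg _ _ hf0.le, ← ENNReal.rpow_mul, ← ENNReal.rpow_mul,
      sub_mul, div_mul_cancel₀ _ hf0.ne', one_mul, ENNReal.rpow_one]
  rw [ENNReal.div_rpow_of_nonneg _ _ hf0.le]
  have hCf : C ^ f = C * C ^ (f - 1) := by
    conv_rhs => rw [← ENNReal.rpow_one C, ← ENNReal.rpow_mul, ← ENNReal.rpow_add _ _ h0 hC]
    congr 1; ring
  have h1 : C ^ f ≠ 0 := by simp [ENNReal.rpow_eq_zero_iff, h0, hC]
  have h2 : C ^ f ≠ ⊤ := ENNReal.rpow_ne_top_of_nonneg hf0.le hC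
  calc C * ((∫⁻ z, w z ∂m) ^ f / C ^ f) ≤ C * (C ^ (f - 1) * I / C ^ f) := by gcongr
    _ = (C * C ^ (f - 1) * I) / C ^ f := by
        rw [mul_assoc, ← mul_div_assoc]
    _ = I := by rw [← hCf, mul_comm, ENNReal.mul_div_cancel_right h1 h2]

/-- Jensen for `levelDisc`. Its inner argument is the linear term p 0 - p 1 plus a term convex by
induction, and the outer map (c, w) ↦ c (w/c)^f is jointly convex and increasing in w. -/
theorem levelDisc_lintegral_le {Z : Type*} [MeasurableSpace Z] (m : Measure Z) [IsFiniteMeasure m]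
    (n : ℕ) {p : ℕ → Z → ℝ≥0∞} (hp : ∀ k, Measurable (p k)) (hp1 : ∀ k z, p k z ≤ 1)
    (hanti : ∀ k < n, ∀ z, p (k + 1) z ≤ p k z) {a : ℕ → ℝ} (ha : ∀ i < n, 1 ≤ a i) :
    levelDisc n (fun k => ∫⁻ z, p k z ∂m) a ≤ ∫⁻ z, levelDisc n (fun k => p k z) a ∂m := by
  induction n generalizing p a with
  | zero => exact zero_le
  | succ n ih =>
    have hfin : ∀ k, ∫⁻ z, p k z ∂m ≠ ⊤ := fun k =>
      ne_top_of_le_ne_top (by simp) (lintegral_mono (hp1 k))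
    have hIH := ih (p := fun k => p (k + 1)) (fun k => hp (k + 1)) (fun k => hp1 (k + 1))
      (fun k hk => hanti (k + 1) (by omega)) (a := fun i => a (i + 1))
      fun i hi => ha (i + 1) (by omega)
    have hmeas := measurable_levelDisc n (p := fun k => p (k + 1)) (fun k => hp (k + 1))
      (fun i => a (i + 1))
    have ha0 : 1 ≤ a 0 := ha 0 (by omega)
    simp only [levelDisc]
    refine le_trans ?_ (lintegral_perspective_rpow_le m (hp 0) (((hp 0).sub (hp 1)).add hmeas)
      (fun z => ne_top_of_le_ne_top ENNReal.one_ne_top (hp1 0 z)) (hfin 0) (fun z hz => ?_) ha0)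
    · have hsub : ∫⁻ z, (p 0 z - p 1 z) + levelDisc n (fun k => p (k + 1) z) (fun i => a (i + 1)) ∂m
          = (∫⁻ z, p 0 z ∂m) - (∫⁻ z, p 1 z ∂m)
            + ∫⁻ z, levelDisc n (fun k => p (k + 1) z) (fun i => a (i + 1)) ∂m := by
        have h01 : Measurable fun z => p 0 z - p 1 z := (hp 0).sub (hp 1)
        rw [lintegral_add_left h01, lintegral_sub (hp 1) (hfin 1)
          (Filter.Eventually.of_forall (hanti 0 (by omega)))]
      simp only [Pi.add_apply, Pi.sub_apply]
      rw [hsub]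
      have : 0 ≤ a 0 := by linarith
      gcongr
    · have h1 : p 1 z = 0 := le_antisymm ((hanti 0 (by omega) z).trans hz.le) zero_le
      simp only [Pi.add_apply, Pi.sub_apply]
      rw [hz, zero_tsub, zero_add]
      exact levelDisc_of_zero n _ h1

/-- Among targets with given level probabilities, products minimize Ψ. Each section at a first label
is compared with its own level probabilities by induction, and Jensen replaces these by their
averages. -/
theorem levelDisc_le_disc (μ : Measure ℝ) [IsProbabilityMeasure μ] (n : ℕ)
    {A : ∀ k, Set (Fin k → ℝ)} (hA : ∀ k, MeasurableSet (A k))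
    (hinit : ∀ (k : ℕ) (z : Fin (k + 1) → ℝ), z ∈ A (k + 1) → (fun i : Fin k => z i.castSucc) ∈ A k)
    {a : ℕ → ℝ} (ha : ∀ i < n, 1 ≤ a i) :
    levelDisc n (fun k => Measure.pi (fun _ : Fin k => μ) (A k)) a ≤ disc μ n (A n) a := by
  induction n generalizing A a with
  | zero => exact zero_le
  | succ n ih =>
    -- The index shifts by one: the k-th set of the sectioned family comes from `A (k + 1)`, so its
    -- probability averages to that of `A (k + 1)`.
    set S : ℝ → ∀ k, Set (Fin k → ℝ) := fun x k =>
      {y | (Fin.cons x y : Fin (k + 1) → ℝ) ∈ A (k + 1)}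
      with hS
    have hSm : ∀ x k, MeasurableSet (S x k) := fun x k => measurableSet_section (hA (k + 1)) x
    have hSi : ∀ x (k : ℕ) (z : Fin (k + 1) → ℝ), z ∈ S x (k + 1) →
        (fun i : Fin k => z i.castSucc) ∈ S x k := by
      intro x k z hz
      have := hinit (k + 1) _ hz
      have e : (fun i : Fin (k + 1) => (Fin.cons x z : Fin (k + 2) → ℝ) i.castSucc) =
          Fin.cons x fun i => z i.castSucc := by
        ext i
        refine Fin.cases ?_ (fun i => ?_) i
        · simp
        · rw [Fin.cons_succ, ← Fin.succ_castSucc, Fin.cons_succ]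
      rwa [e] at this
    set q : ℕ → ℝ → ℝ≥0∞ := fun k x => Measure.pi (fun _ : Fin k => μ) (S x k) with hq
    have hqm : ∀ k, Measurable (q k) := fun k =>
      measurable_measure_prodMk_left (measurable_cons k (hA (k + 1)))
    have hq1 : ∀ k x, q k x ≤ 1 := fun k x => prob_le_one
    have hqanti : ∀ k x, q (k + 1) x ≤ q k x := by
      intro k x
      simp only [hq]
      rw [← (measurePreserving_init μ k).measure_preimage (hSm x k).nullMeasurableSet]
      exact measure_mono fun z hz => hSi x k z hz
    have hqint : ∀ k, ∫⁻ x, q k x ∂μ = Measure.pi (fun _ : Fin (k + 1) => μ) (A (k + 1)) :=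
      fun k => lintegral_measure_section μ (hA (k + 1))
    rw [levelDisc]
    rcases eq_or_ne (Measure.pi (fun _ : Fin 0 => μ) (A 0)) 0 with h0 | h0
    · simp [h0]
    have h01 : Measure.pi (fun _ : Fin 0 => μ) (A 0) = 1 := by
      have : A 0 = Set.univ := Set.eq_univ_of_forall fun z => by
        obtain ⟨z', hz'⟩ := nonempty_of_measure_ne_zero h0
        rwa [Subsingleton.elim z z']
      rw [this, measure_univ]
    rw [h01, one_mul, div_one, disc_succ]
    have ha0 : 0 ≤ a 0 := zero_le_one.trans (ha 0 (by omega))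
    refine ENNReal.rpow_le_rpow ?_ ha0
    have hJ := levelDisc_lintegral_le μ n hqm hq1 (fun k _ => hqanti k)
      (a := fun i => a (i + 1)) fun i hi => ha (i + 1) (by omega)
    simp only [hqint] at hJ
    have hone : 1 - Measure.pi (fun _ : Fin 1 => μ) (A 1) = ∫⁻ x, (1 - q 0 x) ∂μ := by
      rw [lintegral_sub (hqm 0) (by rw [hqint]; exact measure_ne_top _ _)
        (Filter.Eventually.of_forall (hq1 0)), hqint]
      simp
    calc _ ≤ ∫⁻ x, (1 - q 0 x) ∂μ + ∫⁻ x, levelDisc n (fun k => q k x) (fun i => a (i + 1)) ∂μ := by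
          rw [hone]; gcongr
      _ = ∫⁻ x, ((1 - q 0 x) + levelDisc n (fun k => q k x) (fun i => a (i + 1))) ∂μ := by
          have h1 : Measurable fun x => 1 - q 0 x := measurable_const.sub (hqm 0)
          rw [lintegral_add_left h1]
      _ ≤ _ := lintegral_mono fun x => ?_
    -- Either x survives the first level, so that `q 0 x = 1` and the induction applies, or all
    -- sections at x are empty and disconnection is certain.
    by_cases hx : (Fin.elim0 : Fin 0 → ℝ) ∈ S x 0
    · have : q 0 x = 1 := by
        have : S x 0 = Set.univ := Set.eq_univ_of_forall fun z => by
          rwa [Subsingleton.elim z Fin.elim0]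
        simp only [hq]
        rw [this, measure_univ]
      simp only
      rw [this, tsub_self, zero_add]
      exact ih (hSm x) (hSi x) fun i hi => ha (i + 1) (by omega)
    · have hemp : ∀ k, S x k = ∅ := by
        intro k
        induction k with
        | zero =>
          refine Set.eq_empty_of_forall_notMem fun z hz => hx ?_
          rwa [Subsingleton.elim z Fin.elim0] at hz
        | succ k ihk =>
          refine Set.eq_empty_of_forall_notMem fun z hz => ?_
          have := hSi x k z hz
          rw [ihk] at this
          exact this
      have hq0 : q 0 x = 0 := by simp only [hq]; rw [hemp, measure_empty]
      have hd : disc μ n (S x n) (fun i => a (i + 1)) = 1 := by rw [hemp, disc_empty]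
      rw [levelDisc_of_zero n _ hq0, add_zero]
      exact tsub_le_self.trans hd.ge

/-- Measurable modifications of the projections of `B`, compatible with forgetting the last
coordinate. -/
def measurableProj {N : ℕ∞} (μ : Measure ℝ) (B : Set (RPow N)) : ∀ k, Set (Fin k → ℝ)
  | 0 => Set.univ
  | k + 1 => toMeasurable (Measure.pi fun _ => μ) (projSet B (k + 1)) ∩
      {z | (fun i : Fin k => z i.castSucc) ∈ measurableProj μ B k}

section MeasurableProj

variable {N : ℕ∞} (μ : Measure ℝ) (B : Set (RPow N))

theorem measurableSet_measurableProj (k : ℕ) : MeasurableSet (measurableProj μ B k) := by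
  induction k with
  | zero => exact MeasurableSet.univ
  | succ k ih =>
    exact (measurableSet_toMeasurable _ _).inter
      ((measurable_pi_lambda _ fun i => measurable_pi_apply _) ih)

theorem projSet_subset_measurableProj (k : ℕ) : projSet B k ⊆ measurableProj μ B k := by
  induction k with
  | zero => exact Set.subset_univ _
  | succ k ih => exact fun z hz => ⟨subset_toMeasurable _ _ hz, ih (init_mem_projSet hz)⟩

theorem measure_measurableProj [IsProbabilityMeasure μ] (k : ℕ) :
    Measure.pi (fun _ => μ) (measurableProj μ B k) = levelProb μ B k := by
  cases k with
  | zero => rw [levelProb_zero, measurableProj, measure_univ]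
  | succ k =>
    rw [levelProb, if_neg k.succ_ne_zero]
    refine le_antisymm ?_ (measure_mono (projSet_subset_measurableProj μ B _))
    rw [← measure_toMeasurable (projSet B (k + 1))]
    exact measure_mono Set.inter_subset_left

theorem measurableProj_ae_eq [IsProbabilityMeasure μ] {B : Set (RPow N)} (hB : IsClosed B) {k : ℕ}
    (hk : ((k + 1 : ℕ) : ℕ∞) ≤ N) :
    projSet B (k + 1) =ᵐ[Measure.pi fun _ => μ] measurableProj μ B (k + 1) :=
  ae_eq_of_subset_of_measure_ge (projSet_subset_measurableProj μ B _)
    (by rw [measure_measurableProj, levelProb, if_neg k.succ_ne_zero])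
    (nullMeasurableSet_projSet hB hk _) (measure_ne_top _ _)

theorem levelDisc_le_virtualDisc [IsProbabilityMeasure μ] {B : Set (RPow N)} (hB : IsClosed B)
    {n : ℕ} (hn : (n : ℕ∞) ≤ N) {a : ℕ → ℝ} (ha : ∀ i < n, 1 ≤ a i) :
    levelDisc n (levelProb μ B) a ≤ virtualDisc μ n (projSet B n) a := by
  cases n with
  | zero => exact zero_le
  | succ n =>
    rw [virtualDisc_congr_ae μ (n + 1) a (measurableProj_ae_eq μ hB hn),
      virtualDisc_eq_disc μ n (measurableSet_measurableProj μ B _)]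
    refine le_trans (le_of_eq ?_) (levelDisc_le_disc μ (n + 1)
      (measurableSet_measurableProj μ B) (fun k z hz => hz.2) ha)
    simp only [measure_measurableProj]

end MeasurableProj

/-- The disconnection function of a product target set whose factors have probabilities `r`. -/
def productDisc : ℕ → (ℕ → ℝ≥0∞) → (ℕ → ℝ) → ℝ≥0∞
  | 0, _, _ => 0
  | n + 1, r, a =>
      (1 - r 0 + r 0 * productDisc n (fun k => r (k + 1)) fun i => a (i + 1)) ^ a 0

/-- The factor `c` comes out by homogeneity. It has to be general because the tail of the sequence
of products starts at c · r 0 rather than at 1. -/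
theorem levelDisc_prod (n : ℕ) {r : ℕ → ℝ≥0∞} (hr : ∀ i, r i ≤ 1) (a : ℕ → ℝ) {c : ℝ≥0∞}
    (hc : c ≠ ⊤) :
    levelDisc n (fun k => c * ∏ i ∈ Finset.range k, r i) a = c * productDisc n r a := by
  induction n generalizing r a c with
  | zero => simp [levelDisc, productDisc]
  | succ n ih =>
    rcases eq_or_ne c 0 with rfl | h0
    · rw [zero_mul, levelDisc_of_zero _ _ (by simp)]
    have h := ih (r := fun k => r (k + 1)) (fun i => hr (i + 1)) (fun i => a (i + 1))
      (c := c * r 0) (ENNReal.mul_ne_top hc (ne_top_of_le_ne_top ENNReal.one_ne_top (hr 0)))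
    have h' : levelDisc n (fun k => c * ∏ i ∈ Finset.range (k + 1), r i) (fun i => a (i + 1)) =
        c * r 0 * productDisc n (fun k => r (k + 1)) fun i => a (i + 1) := by
      rw [← h]
      refine levelDisc_congr n _ fun k _ => ?_
      rw [Finset.prod_range_succ', mul_comm _ (r 0), mul_assoc]
    rw [levelDisc, productDisc, h']
    have e : c - c * r 0 + c * r 0 * productDisc n (fun k => r (k + 1)) (fun i => a (i + 1)) =
        (1 - r 0 + r 0 * productDisc n (fun k => r (k + 1)) fun i => a (i + 1)) * c := by
      rw [mul_comm _ c, mul_add, ENNReal.mul_sub fun _ _ => hc, mul_one, mul_assoc]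
    simp only [Finset.range_zero, Finset.prod_empty, mul_one, Finset.prod_range_one]
    rw [e, ENNReal.mul_div_cancel_right h0 hc]

/-- The product of half-lines in dimension `n`. -/
def halfLines (n : ℕ) (b : ℕ → EReal) : Set (Fin n → ℝ) := {y | ∀ i : Fin n, (y i : EReal) ≤ b i}

theorem measurableSet_le_coe (b : EReal) : MeasurableSet {x : ℝ | (x : EReal) ≤ b} :=
  measurableSet_le measurable_coe_real_ereal measurable_const

theorem measurableSet_halfLines (n : ℕ) (b : ℕ → EReal) : MeasurableSet (halfLines n b) := by
  simp only [halfLines, Set.ofPred_forall]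
  exact MeasurableSet.iInter fun i =>
    (measurable_pi_apply i : Measurable fun y : Fin n → ℝ => y i) (measurableSet_le_coe (b i))

theorem disc_halfLines (ν : Measure ℝ) [IsProbabilityMeasure ν] (n : ℕ) (b : ℕ → EReal)
    (a : ℕ → ℝ) :
    disc ν n (halfLines n b) a = productDisc n (fun i => ν {x : ℝ | (x : EReal) ≤ b i}) a := by
  induction n generalizing b a with
  | zero => exact disc_zero_of_mem _ (fun i => i.elim0) _
  | succ n ih =>
    rw [disc_succ, productDisc, ← ih (fun i => b (i + 1))]
    congr 1
    have hm := measurableSet_le_coe (b 0)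
    have h : ∀ x : ℝ, disc ν n {y | (Fin.cons x y : Fin (n + 1) → ℝ) ∈ halfLines (n + 1) b}
        (fun i => a (i + 1)) =
        ({x : ℝ | (x : EReal) ≤ b 0}ᶜ).indicator (fun _ => 1) x +
        {x : ℝ | (x : EReal) ≤ b 0}.indicator
          (fun _ => disc ν n (halfLines n fun i => b (i + 1)) fun i => a (i + 1)) x := by
      intro x
      by_cases hx : (x : EReal) ≤ b 0
      · have : {y | (Fin.cons x y : Fin (n + 1) → ℝ) ∈ halfLines (n + 1) b} =
            halfLines n fun i => b (i + 1) := by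
          ext y
          simp [halfLines, Fin.forall_fin_succ, hx]
        simp [this, hx]
      · have : {y | (Fin.cons x y : Fin (n + 1) → ℝ) ∈ halfLines (n + 1) b} = ∅ := by
          ext y
          simp [halfLines, Fin.forall_fin_succ, hx]
        simp [this, hx, disc_empty]
    simp_rw [h]
    rw [lintegral_add_left (measurable_const.indicator hm.compl), lintegral_indicator hm.compl,
      lintegral_indicator hm, setLIntegral_const, setLIntegral_const, one_mul,
      prob_compl_eq_one_sub hm, mul_comm]

/-! ### The resistance bound for product target sets -/

/-- Both sides agree at y = 0. The derivative of the difference is (f + 1)(1 - (1 - y)^(f-1) (1 + (f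
- 1) y)), which is nonnegative because the two factors are at most exp(-(f - 1) y) and exp((f - 1)
y). -/
theorem two_sub_le_rpow_mul {f : ℝ} (hf : 1 ≤ f) {y : ℝ} (hy : y ∈ Set.Icc (0 : ℝ) 1) :
    2 - (f + 1) * y ≤ (1 - y) ^ f * (2 + (f - 1) * y) := by
  have hcont : ContinuousOn (fun y : ℝ => (1 - y) ^ f * (2 + (f - 1) * y) - (2 - (f + 1) * y))
      (Set.Icc 0 1) := by
    have : Continuous fun y : ℝ => (1 - y) ^ f :=
      (Real.continuous_rpow_const (by linarith)).comp (by fun_prop)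
    exact (by fun_prop : Continuous _).continuousOn
  have hderiv : ∀ y ∈ interior (Set.Icc (0 : ℝ) 1), HasDerivWithinAt
      (fun y : ℝ => (1 - y) ^ f * (2 + (f - 1) * y) - (2 - (f + 1) * y))
      ((f + 1) * (1 - (1 - y) ^ (f - 1) * (1 + (f - 1) * y))) (interior (Set.Icc 0 1)) y := by
    intro y hy
    rw [interior_Icc] at hy
    have h1 : HasDerivAt (fun y : ℝ => 1 - y) (-1) y := by
      simpa using (hasDerivAt_id y).const_sub 1
    have h2 := h1.rpow_const (p := f) (Or.inr hf)
    have h3 : HasDerivAt (fun y : ℝ => 2 + (f - 1) * y) (f - 1) y := by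
      simpa using ((hasDerivAt_id y).const_mul (f - 1)).const_add 2
    have h4 : HasDerivAt (fun y : ℝ => 2 - (f + 1) * y) (-(f + 1)) y := by
      simpa using ((hasDerivAt_id y).const_mul (f + 1)).const_sub 2
    refine (((h2.mul h3).sub h4).congr_deriv ?_).hasDerivWithinAt
    have h5 : (1 - y) ^ f = (1 - y) ^ (f - 1) * (1 - y) := by
      rw [← Real.rpow_add_one (by linarith [hy.2]), sub_add_cancel]
    rw [h5]; ring
  have hmono := monotoneOn_of_hasDerivWithinAt_nonneg (convex_Icc (0 : ℝ) 1) hcont hderiv ?_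
  · have := hmono (Set.left_mem_Icc.2 zero_le_one) hy hy.1
    simp only [sub_zero, Real.one_rpow, mul_zero, add_zero, one_mul, sub_self] at this
    linarith
  · intro y hy
    rw [interior_Icc] at hy
    refine mul_nonneg (by linarith) (sub_nonneg.2 ?_)
    have h1 : (1 - y) ^ (f - 1) ≤ Real.exp (-y * (f - 1)) := by
      rw [Real.exp_mul]
      exact Real.rpow_le_rpow (by linarith [hy.2]) (by linarith [Real.add_one_le_exp (-y)])
        (by linarith)
    have h2 : 1 + (f - 1) * y ≤ Real.exp ((f - 1) * y) := by
      linarith [Real.add_one_le_exp ((f - 1) * y)]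
    have h3 : 0 ≤ 1 + (f - 1) * y := by nlinarith [hy.1]
    calc (1 - y) ^ (f - 1) * (1 + (f - 1) * y)
        ≤ Real.exp (-y * (f - 1)) * Real.exp ((f - 1) * y) :=
          mul_le_mul h1 h2 h3 (Real.exp_pos _).le
      _ = 1 := by rw [← Real.exp_add]; ring_nf; exact Real.exp_zero

/-- The induction step of the resistance bound: y is the probability that a given child is retained
and connected onward, 2/y bounds the bracket seen through that child, and the second factor is the
resulting bracket one level higher. -/
theorem one_sub_rpow_mul_le {f : ℝ} (hf : 1 ≤ f) {y : ℝ} (hy0 : 0 < y) (hy1 : y ≤ 1) :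
    (1 - (1 - y) ^ f) * ((1 - 1 / f) + 2 / (f * y)) ≤ 2 := by
  have h := two_sub_le_rpow_mul hf ⟨hy0.le, hy1⟩
  have hf0 : 0 < f := by linarith
  have e : (1 - 1 / f) + 2 / (f * y) = ((f - 1) * y + 2) / (f * y) := by
    field_simp
  rw [e, ← mul_div_assoc, div_le_iff₀ (by positivity)]
  nlinarith

theorem ENNReal.one_sub_rpow_mul_le {f : ℝ} (hf : 1 ≤ f) {y c : ℝ≥0∞} (hy1 : y ≤ 1)
    (hc : c * y ≤ 2) :
    (1 - (1 - y) ^ f) * ((1 - (ENNReal.ofReal f)⁻¹) + (ENNReal.ofReal f)⁻¹ * c) ≤ 2 := by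
  have hf0 : 0 < f := by linarith
  rcases eq_or_ne y 0 with rfl | hy0
  · simp
  lift y to NNReal using ne_top_of_le_ne_top ENNReal.one_ne_top hy1
  have hy0' : (0 : ℝ) < y := by
    have : y ≠ 0 := by exact_mod_cast hy0
    exact_mod_cast pos_iff_ne_zero.2 this
  have hy1' : (y : ℝ) ≤ 1 := by exact_mod_cast hy1
  have hc' : c ≤ ENNReal.ofReal (2 / y) := by
    rw [ENNReal.ofReal_div_of_pos hy0', ENNReal.ofReal_coe_nnreal]
    simpa using (ENNReal.le_div_iff_mul_le (Or.inl hy0) (Or.inl ENNReal.coe_ne_top)).2 hc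
  have e1 : (1 : ℝ≥0∞) - (1 - (y : ℝ≥0∞)) ^ f = ENNReal.ofReal (1 - (1 - (y : ℝ)) ^ f) := by
    rw [ENNReal.ofReal_sub _ (Real.rpow_nonneg (by linarith) _), ENNReal.ofReal_one,
      ← ENNReal.ofReal_rpow_of_nonneg (by linarith) hf0.le, ENNReal.ofReal_sub _ hy0'.le,
      ENNReal.ofReal_one, ENNReal.ofReal_coe_nnreal]
  have e2 : (1 : ℝ≥0∞) - (ENNReal.ofReal f)⁻¹ = ENNReal.ofReal (1 - 1 / f) := by
    rw [ENNReal.ofReal_sub _ (by positivity), ENNReal.ofReal_one, one_div,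
      ENNReal.ofReal_inv_of_pos hf0]
  have h1f : 0 ≤ 1 - 1 / f := by rw [sub_nonneg, div_le_one hf0]; exact hf
  have hz : 0 ≤ 1 - (1 - (y : ℝ)) ^ f :=
    sub_nonneg.2 (Real.rpow_le_one (by linarith) (by linarith) hf0.le)
  calc _ ≤ ENNReal.ofReal (1 - (1 - (y : ℝ)) ^ f) * (ENNReal.ofReal (1 - 1 / f) +
        ENNReal.ofReal (f⁻¹) * ENNReal.ofReal (2 / y)) := by
        rw [e1, e2, ENNReal.ofReal_inv_of_pos hf0]; gcongr
    _ = ENNReal.ofReal ((1 - (1 - (y : ℝ)) ^ f) * ((1 - 1 / f) + 2 / (f * y))) := by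
        rw [← ENNReal.ofReal_mul (by positivity), ← ENNReal.ofReal_add h1f (by positivity),
          ← ENNReal.ofReal_mul hz]
        congr 3
        field_simp
    _ ≤ ENNReal.ofReal 2 := ENNReal.ofReal_le_ofReal (_root_.one_sub_rpow_mul_le hf hy0' hy1')
    _ = 2 := by simp

/-- The bracket in the resistance bound, for a tree of height `n` with level probabilities `p` and
inverse level sizes `u`. -/
def bracket (n : ℕ) (p u : ℕ → ℝ≥0∞) : ℝ≥0∞ :=
  ∑ k ∈ Finset.range n, (p k)⁻¹ * (u k - u (k + 1)) + (p n)⁻¹ * u n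

/-- The recursion at the root: both products equal 1 at index 0, so the term k = 0 is 1 - v 0, while
every later term contains the factors 1/r 0 and v 0. -/
theorem bracket_succ_prod (n : ℕ) {r v : ℕ → ℝ≥0∞} (hr : ∀ i, r i ≤ 1) (hv : ∀ i, v i ≠ ⊤) :
    bracket (n + 1) (fun k => ∏ i ∈ Finset.range k, r i) (fun k => ∏ i ∈ Finset.range k, v i) =
      (1 - v 0) + v 0 * ((r 0)⁻¹ * bracket n (fun k => ∏ i ∈ Finset.range k, r (i + 1))
        fun k => ∏ i ∈ Finset.range k, v (i + 1)) := by
  have hrt : ∀ i, r i ≠ ⊤ := fun i => ne_top_of_le_ne_top ENNReal.one_ne_top (hr i)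
  have hinv : ∀ k, (∏ i ∈ Finset.range (k + 1), r i)⁻¹ =
      (r 0)⁻¹ * (∏ i ∈ Finset.range k, r (i + 1))⁻¹ := by
    intro k
    rw [Finset.prod_range_succ', mul_comm, ENNReal.mul_inv
      (Or.inr (ENNReal.prod_ne_top fun i _ => hrt _))
      (Or.inl (hrt 0))]
  have hvv : ∀ k, ∏ i ∈ Finset.range (k + 1), v i = v 0 * ∏ i ∈ Finset.range k, v (i + 1) := by
    intro k
    rw [Finset.prod_range_succ', mul_comm]
  unfold bracket
  simp only
  rw [Finset.sum_range_succ', mul_add, mul_add, Finset.mul_sum, Finset.mul_sum]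
  simp only [hinv, hvv, Finset.range_zero, Finset.prod_empty, inv_one, one_mul, mul_one]
  rw [add_right_comm, add_comm _ (1 - v 0)]
  congr 2
  · refine Finset.sum_congr rfl fun k _ => ?_
    rw [← ENNReal.mul_sub fun _ _ => hv 0]
    ring
  · ring

theorem productDisc_le_one (n : ℕ) {r : ℕ → ℝ≥0∞} (hr : ∀ i, r i ≤ 1) {a : ℕ → ℝ}
    (ha : ∀ i < n, 0 ≤ a i) : productDisc n r a ≤ 1 := by
  induction n generalizing r a with
  | zero => exact zero_le
  | succ n ih =>
    refine ENNReal.rpow_le_one ?_ (ha 0 (by omega))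
    calc _ ≤ 1 - r 0 + r 0 * 1 := by
          gcongr
          exact ih (fun i => hr (i + 1)) fun i hi => ha (i + 1) (by omega)
      _ = 1 := by rw [mul_one, tsub_add_cancel_of_le (hr 0)]

/-- Induction on the height, with y = r 0 (1 - d) and c equal to 1/r 0 times the bracket of the
remaining levels. At height 0 the product is 1, so the constant 2 is not needed there. -/
theorem one_sub_productDisc_mul_le (n : ℕ) {r : ℕ → ℝ≥0∞} (hr : ∀ i, r i ≤ 1) {a : ℕ → ℝ}
    (ha : ∀ i < n, 1 ≤ a i) {v : ℕ → ℝ≥0∞} (hv : ∀ i < n, v i = (ENNReal.ofReal (a i))⁻¹)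
    (hvt : ∀ i, v i ≠ ⊤) :
    (1 - productDisc n r a) * bracket n (fun k => ∏ i ∈ Finset.range k, r i)
      (fun k => ∏ i ∈ Finset.range k, v i) ≤ 2 := by
  induction n generalizing r a v with
  | zero => simp [productDisc, bracket]
  | succ n ih =>
    rw [bracket_succ_prod n hr hvt, productDisc, hv 0 (by omega)]
    set d := productDisc n (fun k => r (k + 1)) fun i => a (i + 1) with hd
    have hd1 : d ≤ 1 := productDisc_le_one n (fun i => hr (i + 1)) fun i hi =>
      zero_le_one.trans (ha (i + 1) (by omega))
    have hIH := ih (fun i => hr (i + 1)) (fun i hi => ha (i + 1) (by omega))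
      (v := fun i => v (i + 1)) (fun i hi => hv (i + 1) (by omega)) fun i => hvt (i + 1)
    have hrt : r 0 ≠ ⊤ := ne_top_of_le_ne_top ENNReal.one_ne_top (hr 0)
    have e : 1 - r 0 + r 0 * d = 1 - r 0 * (1 - d) := by
      have h1 : r 0 * (1 - d) ≤ 1 := mul_le_one' (hr 0) tsub_le_self
      refine ENNReal.eq_sub_of_add_eq (ne_top_of_le_ne_top ENNReal.one_ne_top h1) ?_
      rw [add_assoc, ← mul_add, add_tsub_cancel_of_le hd1, mul_one, tsub_add_cancel_of_le (hr 0)]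
    rw [e]
    refine ENNReal.one_sub_rpow_mul_le (ha 0 (by omega)) (mul_le_one' (hr 0) tsub_le_self) ?_
    -- Only r 0 · (r 0)⁻¹ ≤ 1 is used, which remains valid when r 0 = 0.
    rw [mul_comm, mul_mul_mul_comm]
    refine (mul_le_mul' (ENNReal.mul_inv_le_one _) hIH).trans_eq (one_mul _)

/-! ### The product target set -/

theorem projSet_productTarget_subset {N : ℕ∞} (b : ℕ → EReal) {n : ℕ} (hn : (n : ℕ∞) ≤ N) :
    projSet (productTarget N b) n ⊆ halfLines n b := by
  rintro z ⟨y, hy, h⟩ i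
  have hi : ((i : ℕ) : ℕ∞) < N := lt_of_lt_of_le (by exact_mod_cast i.2) hn
  rw [h i hi]
  exact hy ⟨i, hi⟩

theorem projSet_productTarget_eq {N : ℕ∞} {b : ℕ → EReal} {n : ℕ} (hn : (n : ℕ∞) ≤ N)
    (hb : ∀ i, n ≤ i → (i : ℕ∞) < N → b i ≠ ⊥) :
    projSet (productTarget N b) n = halfLines n b := by
  refine (projSet_productTarget_subset b hn).antisymm fun z hz => ?_
  refine ⟨fun i => if h : (i : ℕ) < n then z ⟨i, h⟩ else (b i).toReal, ?_, ?_⟩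
  · intro i
    simp only
    split_ifs with h
    · exact hz ⟨i, h⟩
    -- The missing coordinates are filled with the thresholds themselves; an infinite threshold ⊤
    -- gives the default value 0, which is still admissible.
    · exact EReal.coe_toReal_le (hb i (not_lt.1 h) i.2)
  · intro i hi
    simp

/-- One threshold b i = -∞ empties the whole target and all its projections, whereas `halfLines n b`
is only guaranteed to be empty for n > i. Large n suffice for the limit. -/
theorem eventually_projSet_productTarget_eq (b : ℕ → EReal) :
    ∀ᶠ n in Filter.atTop, projSet (productTarget ⊤ b) n = halfLines n b := by
  by_cases h : ∃ i, b i = ⊥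
  · obtain ⟨i, hi⟩ := h
    filter_upwards [Filter.eventually_gt_atTop i] with n hn
    have hemp : halfLines n b = ∅ := by
      refine Set.eq_empty_of_forall_notMem fun z hz => ?_
      have := hz ⟨i, hn⟩
      simp [hi] at this
    exact (projSet_productTarget_subset b le_top).antisymm (hemp ▸ Set.empty_subset _)
  · push Not at h
    exact Filter.Eventually.of_forall fun n => projSet_productTarget_eq le_top fun i _ _ => h i

theorem virtualDisc_halfLines (ν : Measure ℝ) [IsProbabilityMeasure ν] (n : ℕ) (b : ℕ → EReal)
    (a : ℕ → ℝ) :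
    virtualDisc ν n (halfLines n b) a =
      productDisc n (fun i => ν {x : ℝ | (x : EReal) ≤ b i}) a := by
  cases n with
  | zero => rfl
  | succ n => rw [virtualDisc_eq_disc ν n (measurableSet_halfLines _ b), disc_halfLines]

theorem productDisc_le_virtualDisc {N : ℕ∞} (μ ν : Measure ℝ) [IsProbabilityMeasure μ]
    [IsProbabilityMeasure ν] {B : Set (RPow N)} (hB : IsClosed B) {b : ℕ → EReal}
    (hb : MatchesLevels N ν (levelProb μ B) b) {n : ℕ} (hn : (n : ℕ∞) ≤ N) {a : ℕ → ℝ}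
    (ha : ∀ i < n, 1 ≤ a i) :
    productDisc n (fun i => ν {x : ℝ | (x : EReal) ≤ b i}) a ≤
      virtualDisc μ n (projSet B n) a := by
  refine le_trans (le_of_eq ?_) (levelDisc_le_virtualDisc μ hB hn ha)
  rw [← one_mul (productDisc _ _ _), ← levelDisc_prod n (fun i => prob_le_one) a ENNReal.one_ne_top]
  refine levelDisc_congr n a fun k hk => ?_
  rw [one_mul]
  exact hb k (le_trans (by exact_mod_cast hk) hn)

/-! ### The resistance bound -/

theorem bracket_congr {n : ℕ} {p q u v : ℕ → ℝ≥0∞} (hp : ∀ k ≤ n, p k = q k)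
    (hu : ∀ k ≤ n, u k = v k) : bracket n p u = bracket n q v := by
  unfold bracket
  rw [hp n le_rfl, hu n le_rfl]
  congr 1
  refine Finset.sum_congr rfl fun k hk => ?_
  have := Finset.mem_range.1 hk
  rw [hp k (by omega), hu k (by omega), hu (k + 1) (by omega)]

namespace LevelTree

variable {N : ℕ∞} (Γ : LevelTree.{u} N)

/-- The inverse level size, with the value `0` beyond the height of the tree. -/
def invCard (k : ℕ) : ℝ≥0∞ := if (k : ℕ∞) ≤ N then (Γ.card k : ℝ≥0∞)⁻¹ else 0

theorem invCard_of_le {k : ℕ} (hk : (k : ℕ∞) ≤ N) : Γ.invCard k = (Γ.card k : ℝ≥0∞)⁻¹ :=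
  if_pos hk

theorem invCard_of_lt {k : ℕ} (hk : N < (k : ℕ∞)) : Γ.invCard k = 0 := if_neg hk.not_ge

theorem invCard_antitone : Antitone Γ.invCard := by
  refine antitone_nat_of_succ_le fun k => ?_
  by_cases hk : ((k + 1 : ℕ) : ℕ∞) ≤ N
  · rw [Γ.invCard_of_le hk, Γ.invCard_of_le (le_trans (by exact_mod_cast k.le_succ) hk)]
    exact ENNReal.inv_le_inv.2 (by exact_mod_cast Γ.card_le_card_succ hk)
  · rw [Γ.invCard_of_lt (not_le.1 hk)]; exact zero_le

theorem invCard_le_one (k : ℕ) : Γ.invCard k ≤ 1 := by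
  refine (Γ.invCard_antitone k.zero_le).trans_eq ?_
  rw [Γ.invCard_of_le (by simp), card_zero]
  simp

theorem invCard_eq_prod {n : ℕ} (hn : (n : ℕ∞) ≤ N) :
    Γ.invCard n = ∏ i ∈ Finset.range n,
      if ((i + 1 : ℕ) : ℕ∞) ≤ N then (ENNReal.ofReal (Γ.growth i))⁻¹ else 1 := by
  induction n with
  | zero => simp [invCard, card_zero]
  | succ n ih =>
    have hn' : (n : ℕ∞) ≤ N := le_trans (by exact_mod_cast n.le_succ) hn
    rw [Finset.prod_range_succ, ← ih hn', if_pos hn, Γ.invCard_of_le hn, Γ.invCard_of_le hn',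
      growth]
    have h0 : (0 : ℝ) < Γ.card n := by exact_mod_cast Γ.card_pos hn'
    have h1 : (Γ.card n : ℝ≥0∞) ≠ 0 := by exact_mod_cast (Γ.card_pos hn').ne'
    have h2 : (Γ.card (n + 1) : ℝ≥0∞) ≠ 0 := by exact_mod_cast (Γ.card_pos hn).ne'
    rw [ENNReal.ofReal_div_of_pos h0, ENNReal.ofReal_natCast, ENNReal.ofReal_natCast,
      ENNReal.inv_div (Or.inl (by simp)) (Or.inl h1), ← mul_div_assoc,
      ENNReal.inv_mul_cancel h1 (by simp), one_div]

/-- Since `invCard` vanishes beyond the height, the boundary term for finite `N` is just the term k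
= N of the series, so finite and infinite heights share one formula. -/
theorem resistanceBound_eq_tsum (p : ℕ → ℝ≥0∞) :
    resistanceBound Γ p = 2 * (∑' k, (p k)⁻¹ * (Γ.invCard k - Γ.invCard (k + 1)))⁻¹ := by
  unfold resistanceBound
  congr 2
  have hsub : ∑' k : {k : ℕ // (k : ℕ∞) < N},
      (p k)⁻¹ * ((Γ.card k : ℝ≥0∞)⁻¹ - (Γ.card (k + 1) : ℝ≥0∞)⁻¹) =
      ∑' k : ℕ, if (k : ℕ∞) < N then (p k)⁻¹ * (Γ.invCard k - Γ.invCard (k + 1)) else 0 := by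
    rw [← Function.Injective.tsum_eq (g := fun k : {k : ℕ // (k : ℕ∞) < N} => (k : ℕ))
      Subtype.val_injective]
    · refine tsum_congr fun k => ?_
      rw [if_pos k.2, Γ.invCard_of_le k.2.le,
        Γ.invCard_of_le (by exact_mod_cast Order.add_one_le_of_lt k.2)]
    · intro k hk
      by_contra hcon
      exact hk (if_neg fun h => hcon ⟨⟨k, h⟩, rfl⟩)
  rw [hsub]
  by_cases hN : N = ⊤
  · subst hN
    simp
  · rw [if_neg hN]
    obtain ⟨n, rfl⟩ := ENat.ne_top_iff_exists.1 hN
    rw [tsum_eq_sum (s := Finset.range n), tsum_eq_sum (s := Finset.range (n + 1)),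
      Finset.sum_range_succ, add_comm]
    · congr 1
      · refine Finset.sum_congr rfl fun k hk => if_pos ?_
        exact_mod_cast Finset.mem_range.1 hk
      · rw [Γ.invCard_of_le le_rfl, Γ.invCard_of_lt (by exact_mod_cast n.lt_succ_self)]
        simp
    · intro k hk
      have hk' : n < k := by simpa using hk
      rw [Γ.invCard_of_lt (by exact_mod_cast hk'),
        Γ.invCard_of_lt (by exact_mod_cast hk'.trans k.lt_succ_self)]
      simp
    · intro k hk
      have hk' : n ≤ k := by simpa using hk
      exact if_neg (by exact_mod_cast hk'.not_gt)

theorem one_sub_productDisc_le {p r : ℕ → ℝ≥0∞} (hr : ∀ i, r i ≤ 1) {n : ℕ} (hn : (n : ℕ∞) ≤ N)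
    (hp : ∀ k ≤ n, ∏ i ∈ Finset.range k, r i = p k) :
    1 - productDisc n r Γ.growth ≤ 2 * (bracket n p Γ.invCard)⁻¹ := by
  have hle : ∀ i < n, ((i + 1 : ℕ) : ℕ∞) ≤ N := fun i hi => le_trans (by exact_mod_cast hi) hn
  have h := one_sub_productDisc_mul_le n hr (fun i hi => Γ.one_le_growth (hle i hi))
    (v := fun i => if ((i + 1 : ℕ) : ℕ∞) ≤ N then (ENNReal.ofReal (Γ.growth i))⁻¹ else 1)
    (fun i hi => if_pos (hle i hi)) fun i => by
      split_ifs with hi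
      · have := Γ.one_le_growth hi
        simp only [ne_eq, ENNReal.inv_eq_top, ENNReal.ofReal_eq_zero, not_le]
        linarith
      · exact ENNReal.one_ne_top
  rw [← div_eq_mul_inv, ENNReal.le_div_iff_mul_le (Or.inr (by simp)) (Or.inr (by simp))]
  refine le_trans (le_of_eq ?_) h
  congr 1
  exact bracket_congr (fun k hk => (hp k hk).symm)
    fun k hk => Γ.invCard_eq_prod (le_trans (by exact_mod_cast hk) hn)

/-! ### The chain of inequalities for finite and infinite height -/

variable {Ω : Type*} [MeasurableSpace Ω] {P : Measure Ω} [IsProbabilityMeasure P]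
  {X : Γ.NonRoot → Ω → ℝ} {μ : Measure ℝ} [IsProbabilityMeasure μ]

theorem measure_connBoundary_le_virtualConn (hX : ∀ σ, Measurable (X σ))
    (hlaw : ∀ σ, P.map (X σ) = μ) (hindep : iIndepFun X P) {B : Set (RPow N)} (hB : IsClosed B) :
    P {ω | Γ.ConnBoundary B fun τ => X τ ω} ≤ virtualConn μ B Γ.growth := by
  unfold virtualConn
  split_ifs with hN
  · subst hN
    rw [← Filter.limsup_const (f := Filter.atTop (α := ℕ))
      (P {ω | Γ.ConnBoundary B fun τ => X τ ω})]
    exact Filter.limsup_le_limsup (Filter.Eventually.of_forall fun n =>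
      Γ.measure_connBoundary_le hX hlaw hindep hB le_top)
  · exact Γ.measure_connBoundary_le hX hlaw hindep hB (ENat.natCast_toNat_le_self N)

theorem virtualConn_productTarget (ν : Measure ℝ) [IsProbabilityMeasure ν] (b : ℕ → EReal)
    (a : ℕ → ℝ) :
    virtualConn ν (productTarget N b) a = if N = ⊤ then
      Filter.limsup (fun n : ℕ =>
        1 - productDisc n (fun i => ν {x : ℝ | (x : EReal) ≤ b i}) a) Filter.atTop
      else 1 - productDisc N.toNat (fun i => ν {x : ℝ | (x : EReal) ≤ b i}) a := by
  unfold virtualConn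
  split_ifs with hN
  · subst hN
    refine Filter.limsup_congr ?_
    filter_upwards [eventually_projSet_productTarget_eq b] with n hn
    rw [hn, virtualDisc_halfLines]
  · rw [projSet_productTarget_eq (ENat.natCast_toNat_le_self N), virtualDisc_halfLines]
    intro i h1 h2
    rw [← ENat.natCast_toNat hN] at h2
    exact absurd h1 (by exact_mod_cast h2.not_ge)

theorem virtualConn_le_virtualConn_productTarget (μ ν : Measure ℝ) [IsProbabilityMeasure μ]
    [IsProbabilityMeasure ν] {B : Set (RPow N)} (hB : IsClosed B) {b : ℕ → EReal}
    (hb : MatchesLevels N ν (levelProb μ B) b) :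
    virtualConn μ B Γ.growth ≤ virtualConn ν (productTarget N b) Γ.growth := by
  have key : ∀ n : ℕ, (n : ℕ∞) ≤ N → 1 - virtualDisc μ n (projSet B n) Γ.growth ≤
      1 - productDisc n (fun i => ν {x : ℝ | (x : EReal) ≤ b i}) Γ.growth := fun n hn =>
    tsub_le_tsub_left (productDisc_le_virtualDisc μ ν hB hb hn fun i hi =>
      Γ.one_le_growth (le_trans (by exact_mod_cast hi) hn)) 1
  rw [virtualConn_productTarget, virtualConn]
  split_ifs with hN
  · subst hN
    exact Filter.limsup_le_limsup (Filter.Eventually.of_forall fun n => key n le_top)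
  · exact key _ (ENat.natCast_toNat_le_self N)

theorem virtualConn_productTarget_le_resistanceBound (ν : Measure ℝ) [IsProbabilityMeasure ν]
    {p : ℕ → ℝ≥0∞} {b : ℕ → EReal} (hb : MatchesLevels N ν p b) :
    virtualConn ν (productTarget N b) Γ.growth ≤ resistanceBound Γ p := by
  have key : ∀ n : ℕ, (n : ℕ∞) ≤ N →
      1 - productDisc n (fun i => ν {x : ℝ | (x : EReal) ≤ b i}) Γ.growth ≤
        2 * (bracket n p Γ.invCard)⁻¹ := fun n hn =>
    Γ.one_sub_productDisc_le (fun i => prob_le_one) hn fun k hk =>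
      hb k (le_trans (by exact_mod_cast hk) hn)
  rw [virtualConn_productTarget, resistanceBound_eq_tsum]
  split_ifs with hN
  · subst hN
    have hlim : Filter.Tendsto (fun n => 2 * (∑ k ∈ Finset.range n,
        (p k)⁻¹ * (Γ.invCard k - Γ.invCard (k + 1)))⁻¹) Filter.atTop
        (nhds (2 * (∑' k, (p k)⁻¹ * (Γ.invCard k - Γ.invCard (k + 1)))⁻¹)) :=
      ENNReal.Tendsto.const_mul (tendsto_inv_iff.2 (ENNReal.tendsto_nat_tsum _))
        (Or.inr (by simp))
    rw [← hlim.limsup_eq]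
    refine Filter.limsup_le_limsup (Filter.Eventually.of_forall fun n =>
      (key n le_top).trans ?_)
    -- Dropping the boundary term of the bracket only enlarges its inverse; what remains are the
    -- partial sums of the series.
    refine mul_le_mul_right (ENNReal.inv_le_inv.2 ?_) _
    exact le_self_add
  · refine (key _ (ENat.natCast_toNat_le_self N)).trans ?_
    refine mul_le_mul_right (ENNReal.inv_le_inv.2 ?_) _
    obtain ⟨n, rfl⟩ := ENat.ne_top_iff_exists.1 hN
    rw [tsum_eq_sum (s := Finset.range (n + 1)), Finset.sum_range_succ, bracket,
      Γ.invCard_of_lt (k := n + 1) (by exact_mod_cast n.lt_succ_self), tsub_zero]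
    · rfl
    · intro k hk
      have hk' : n < k := by simpa using hk
      rw [Γ.invCard_of_lt (by exact_mod_cast hk'), zero_tsub, mul_zero]

end LevelTree

/-! ### Thresholds -/

/-- Without atoms the distribution function is continuous, and the intermediate value theorem
reaches every value strictly between 0 and 1. The extreme values are realized by ∓∞. -/
theorem exists_threshold (ν : Measure ℝ) [IsProbabilityMeasure ν] (hν : ∀ x : ℝ, ν {x} = 0)
    {r : ℝ≥0∞} (hr : r ≤ 1) : ∃ b : EReal, ν {x : ℝ | (x : EReal) ≤ b} = r := by
  rcases eq_or_ne r 0 with rfl | h0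
  · exact ⟨⊥, by simp⟩
  rcases eq_or_ne r 1 with rfl | h1
  · exact ⟨⊤, by simp⟩
  lift r to NNReal using ne_top_of_le_ne_top ENNReal.one_ne_top hr
  have hcont : Continuous (cdf ν) := by
    refine continuous_iff_continuousAt.2 fun x => ?_
    rw [(monotone_cdf ν).continuousAt_iff_leftLim_eq_rightLim, (cdf ν).rightLim_eq]
    have h := hν x
    rw [← measure_cdf ν, StieltjesFunction.measure_singleton, ENNReal.ofReal_eq_zero] at h
    exact le_antisymm ((monotone_cdf ν).leftLim_le le_rfl) (by linarith)
  have hr0 : (0 : ℝ) < r := by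
    have : r ≠ 0 := by exact_mod_cast h0
    exact_mod_cast pos_iff_ne_zero.2 this
  have hr1 : (r : ℝ) < 1 := by
    have h2 : r ≤ 1 := by exact_mod_cast hr
    have h3 : r ≠ 1 := by exact_mod_cast h1
    exact_mod_cast lt_of_le_of_ne h2 h3
  obtain ⟨x, hx⟩ := mem_range_of_exists_le_of_exists_ge hcont
    (((tendsto_cdf_atBot ν).eventually (eventually_le_nhds hr0)).exists)
    (((tendsto_cdf_atTop ν).eventually (eventually_ge_nhds hr1)).exists)
  refine ⟨x, ?_⟩
  have : {y : ℝ | (y : EReal) ≤ (x : EReal)} = Set.Iic x := by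
    ext y; simp
  rw [this, ← ofReal_cdf, hx, ENNReal.ofReal_coe_nnreal]

theorem exists_matchesLevels (N : ℕ∞) (ν : Measure ℝ) [IsProbabilityMeasure ν]
    (hν : ∀ x : ℝ, ν {x} = 0) {p : ℕ → ℝ≥0∞} (hp0 : p 0 = 1) (hp : Antitone p) :
    ∃ b : ℕ → EReal, MatchesLevels N ν p b := by
  have hle : ∀ k, p k ≤ 1 := fun k => hp0 ▸ hp k.zero_le
  -- The i-th half-line receives the conditional survival probability p (i + 1) / p i. Once p
  -- vanishes, the product stays 0 whatever the later ratios are.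
  choose b hb using fun i => exists_threshold ν hν (r := p (i + 1) / p i)
    (ENNReal.div_le_of_le_mul (by rw [one_mul]; exact hp i.le_succ))
  refine ⟨b, fun n hn => ?_⟩
  induction n with
  | zero => simp [hp0]
  | succ n ih =>
    rw [Finset.prod_range_succ, ih (le_trans (by exact_mod_cast n.le_succ) hn), hb]
    rcases eq_or_ne (p n) 0 with h | h
    · rw [h, zero_mul]
      exact (le_antisymm ((hp n.le_succ).trans h.le) zero_le).symm
    · exact ENNReal.mul_div_cancel h (ne_top_of_le_ne_top ENNReal.one_ne_top (hle n))

/-! ### Summation by parts -/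

/-- The increments of a sequence, starting with its value at `0`. -/
def increment (a : ℕ → ℝ≥0∞) : ℕ → ℝ≥0∞
  | 0 => a 0
  | k + 1 => a (k + 1) - a k

/-- The value ∞ is allowed: once `a` is infinite the truncated increments ⊤ - ⊤ = 0 do no harm, as
the partial sum is already infinite. This covers levels where p = 0. -/
theorem sum_increment {a : ℕ → ℝ≥0∞} (ha : Monotone a) (n : ℕ) :
    ∑ k ∈ Finset.range (n + 1), increment a k = a n := by
  induction n with
  | zero => simp [increment]
  | succ n ih =>
    rw [Finset.sum_range_succ, ih, increment, add_tsub_cancel_of_le (ha n.le_succ)]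

theorem tsum_increment {a : ℕ → ℝ≥0∞} (ha : Monotone a) : ∑' k, increment a k = ⨆ n, a n := by
  rw [ENNReal.tsum_eq_iSup_nat' (Filter.tendsto_add_atTop_nat 1)]
  simp only [sum_increment ha]

theorem tsum_sub_succ_of_tendsto_zero {u : ℕ → ℝ≥0∞} (hu : Antitone u) (hu1 : u 0 ≠ ⊤)
    (hlim : Filter.Tendsto u Filter.atTop (nhds 0)) (j : ℕ) :
    ∑' k, (if j ≤ k then u k - u (k + 1) else 0) = u j := by
  have huj : u j ≠ ⊤ := ne_top_of_le_ne_top hu1 (hu j.zero_le)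
  have hsum : ∀ n, j ≤ n →
      ∑ k ∈ Finset.range n, (if j ≤ k then u k - u (k + 1) else 0) = u j - u n := by
    intro n hn
    induction n, hn using Nat.le_induction with
    | base =>
      rw [tsub_self]
      exact Finset.sum_eq_zero fun k hk => if_neg (by simpa using hk)
    | succ n hn ih =>
      rw [Finset.sum_range_succ, ih, if_pos hn, tsub_add_tsub_cancel (hu hn) (hu n.le_succ)]
  refine tendsto_nhds_unique (ENNReal.tendsto_nat_tsum _) ?_
  have h : Filter.Tendsto (fun n => u j - u n) Filter.atTop (nhds (u j - 0)) :=
    ENNReal.Tendsto.sub tendsto_const_nhds hlim (Or.inl huj)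
  rw [tsub_zero] at h
  refine h.congr' ?_
  filter_upwards [Filter.eventually_ge_atTop j] with n hn
  exact (hsum n hn).symm

/-- Abel summation as Tonelli over the pairs j ≤ k. The limit 0 of `u` is what makes the tail of
differences from j on telescope to `u j`. -/
theorem tsum_mul_sub_succ {a u : ℕ → ℝ≥0∞} (ha : Monotone a) (hu : Antitone u) (hu1 : u 0 ≠ ⊤)
    (hlim : Filter.Tendsto u Filter.atTop (nhds 0)) :
    ∑' k, a k * (u k - u (k + 1)) = ∑' j, increment a j * u j := by
  calc ∑' k, a k * (u k - u (k + 1))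
      = ∑' k, ∑' j, increment a j * (if j ≤ k then u k - u (k + 1) else 0) := by
        refine tsum_congr fun k => ?_
        rw [tsum_eq_sum (s := Finset.range (k + 1)), ← sum_increment ha k, Finset.sum_mul]
        · refine Finset.sum_congr rfl fun j hj => ?_
          rw [if_pos (by simpa [Nat.lt_succ_iff] using hj)]
        · intro j hj
          rw [if_neg (by simpa [Nat.lt_succ_iff] using hj), mul_zero]
    _ = ∑' j, increment a j * u j := by
        rw [ENNReal.tsum_comm]
        refine tsum_congr fun j => ?_
        rw [ENNReal.tsum_mul_left, tsum_sub_succ_of_tendsto_zero hu hu1 hlim]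

/-- Cauchy–Schwarz, carried out in the nonnegative reals. -/
theorem inv_card_le_sum_sq {ι : Type*} [Fintype ι] {x : ι → ℝ≥0∞} (hx : ∑ i, x i = 1) :
    (Fintype.card ι : ℝ≥0∞)⁻¹ ≤ ∑ i, x i * x i := by
  have hxt : ∀ i, x i ≠ ⊤ := fun i => ne_top_of_le_ne_top ENNReal.one_ne_top
    (hx ▸ Finset.single_le_sum (f := x) (fun _ _ => zero_le) (Finset.mem_univ i))
  obtain ⟨y, rfl⟩ : ∃ y : ι → NNReal, x = fun i => (y i : ℝ≥0∞) :=
    ⟨fun i => (x i).toNNReal, funext fun i => (ENNReal.coe_toNNReal (hxt i)).symm⟩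
  beta_reduce at hx ⊢
  have h1 : ∑ i, y i = 1 := by exact_mod_cast hx
  have h := sq_sum_le_card_mul_sum_sq (s := Finset.univ) (f := y)
  rw [h1, one_pow, Finset.card_univ] at h
  rw [ENNReal.inv_le_iff_le_mul (fun h => absurd h (ENNReal.sum_ne_top.2 fun i _ =>
    ENNReal.mul_ne_top ENNReal.coe_ne_top ENNReal.coe_ne_top)) (fun h => absurd h (by simp))]
  simp only [sq] at h
  exact_mod_cast h

/-! ### Energy and capacity -/

namespace LevelTree

variable {N : ℕ∞} (Γ : LevelTree.{u} N)

/-- The rays `ξ` and `η` share a vertex in level `j`. -/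
def Agree (ξ η : Γ.Ray) (j : ℕ) : Prop := ∃ h : (j : ℕ∞) ≤ N, ξ.vertex j h = η.vertex j h

variable {Γ}

theorem Agree.of_succ {ξ η : Γ.Ray} {j : ℕ} (h : Γ.Agree ξ η (j + 1)) : Γ.Agree ξ η j := by
  obtain ⟨h1, h2⟩ := h
  have h0 : (j : ℕ∞) ≤ N := le_trans (by exact_mod_cast j.le_succ) h1
  exact ⟨h0, by rw [← ξ.parent_vertex j h0 h1, ← η.parent_vertex j h0 h1, h2]⟩

theorem Agree.mono {ξ η : Γ.Ray} {i j : ℕ} (hij : i ≤ j) (h : Γ.Agree ξ η j) :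
    Γ.Agree ξ η i := by
  induction j, hij using Nat.le_induction with
  | base => exact h
  | succ j _ ih => exact ih h.of_succ

theorem agree_zero (ξ η : Γ.Ray) : Γ.Agree ξ η 0 :=
  ⟨by simp, (Γ.eq_root _).trans (Γ.eq_root _).symm⟩

-- The levels in which two rays agree form an initial segment, over which the increments of 1/p
-- telescope. Agreement in all levels forces infinite height and gives the supremum of 1/p, matching
-- the infimum in `gaugeAt`.
open Classical in
theorem inv_gaugeAt_meetDepth {p : ℕ → ℝ≥0∞} (hp : Antitone p) (ξ η : Γ.Ray) :
    (gaugeAt p (Γ.meetDepth ξ η))⁻¹ =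
      ∑' j, increment (fun k => (p k)⁻¹) j * if Γ.Agree ξ η j then 1 else 0 := by
  have ha : Monotone fun k => (p k)⁻¹ := fun i j h => ENNReal.inv_le_inv.2 (hp h)
  by_cases hall : ∀ j, Γ.Agree ξ η j
  · have hmeet : Γ.meetDepth ξ η = ⊤ := by
      refine ENat.eq_top_iff_forall_ge.2 fun n => ?_
      obtain ⟨h1, h2⟩ := hall n
      exact le_iSup_of_le n (le_iSup₂_of_le h1 h2 le_rfl)
    simp only [hall, if_true, mul_one]
    rw [hmeet, gaugeAt, if_pos rfl, tsum_increment ha, ENNReal.inv_iInf]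
  · push Not at hall
    obtain ⟨k, hk⟩ : ∃ k, Nat.find hall = k + 1 :=
      Nat.exists_eq_succ_of_ne_zero fun h => (h ▸ Nat.find_spec hall) (agree_zero ξ η)
    have hiff : ∀ j, Γ.Agree ξ η j ↔ j ≤ k := by
      intro j
      constructor
      · intro h
        by_contra hj
        exact Nat.find_spec hall (h.mono (by omega))
      · intro h
        by_contra hj
        have := Nat.find_min' hall hj
        omega
    have hmeet : Γ.meetDepth ξ η = k := by
      refine le_antisymm (iSup_le fun n => iSup₂_le fun h1 h2 => ?_) ?_
      · exact_mod_cast (hiff n).1 ⟨h1, h2⟩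
      · obtain ⟨h1, h2⟩ := (hiff k).2 le_rfl
        exact le_iSup_of_le k (le_iSup₂_of_le h1 h2 le_rfl)
    rw [hmeet, gaugeAt, if_neg (by simp), ENat.toNat_natCast,
      tsum_eq_sum (s := Finset.range (k + 1)),
      ← sum_increment ha k]
    · refine Finset.sum_congr rfl fun j hj => ?_
      rw [if_pos ((hiff j).2 (by simpa [Nat.lt_succ_iff] using hj)), mul_one]
    · intro j hj
      rw [if_neg (fun h => hj (by simpa [Nat.lt_succ_iff] using (hiff j).1 h)), mul_zero]

theorem measurableSet_cylinder {n : ℕ} (h : (n : ℕ∞) ≤ N) (σ : Γ.level n) :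
    MeasurableSet {ξ : Γ.Ray | ξ.vertex n h = σ} :=
  MeasurableSpace.measurableSet_generateFrom ⟨n, h, σ, rfl⟩

theorem measurableSet_agree (ξ : Γ.Ray) (j : ℕ) : MeasurableSet {η | Γ.Agree ξ η j} := by
  by_cases h : (j : ℕ∞) ≤ N
  · convert measurableSet_cylinder h (ξ.vertex j h) using 1
    ext η
    exact ⟨fun ⟨_, h2⟩ => h2.symm, fun h2 => ⟨h, h2.symm⟩⟩
  · convert MeasurableSet.empty
    ext η
    exact ⟨fun ⟨h1, _⟩ => h h1, fun h => h.elim⟩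

theorem measure_agree_eq_sum {j : ℕ} (h : (j : ℕ∞) ≤ N) (m : Measure Γ.Ray) (ξ : Γ.Ray) :
    m {η | Γ.Agree ξ η j} = ∑ σ, {ξ : Γ.Ray | ξ.vertex j h = σ}.indicator
      (fun _ => m {η | η.vertex j h = σ}) ξ := by
  rw [Finset.sum_eq_single (ξ.vertex j h)]
  · rw [Set.indicator_of_mem (by exact rfl)]
    congr 1
    ext η
    exact ⟨fun ⟨_, h2⟩ => h2.symm, fun h2 => ⟨h, h2.symm⟩⟩
  · intro σ _ hσ
    exact Set.indicator_of_notMem (fun h' => hσ h'.symm) _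
  · simp

theorem measurable_measure_agree (m : Measure Γ.Ray) (j : ℕ) :
    Measurable fun ξ => m {η | Γ.Agree ξ η j} := by
  by_cases h : (j : ℕ∞) ≤ N
  · simp only [measure_agree_eq_sum h]
    exact Finset.measurable_sum _ fun σ _ =>
      measurable_const.indicator (measurableSet_cylinder h σ)
  · have : ∀ ξ : Γ.Ray, {η | Γ.Agree ξ η j} = ∅ := fun ξ => by
      ext η
      exact ⟨fun ⟨h1, _⟩ => h h1, fun h => h.elim⟩
    simp only [this, measure_empty]
    exact measurable_const

theorem lintegral_measure_agree {j : ℕ} (h : (j : ℕ∞) ≤ N) (m : Measure Γ.Ray) :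
    ∫⁻ ξ, m {η | Γ.Agree ξ η j} ∂m =
      ∑ σ, m {ξ | ξ.vertex j h = σ} * m {ξ | ξ.vertex j h = σ} := by
  simp only [measure_agree_eq_sum h]
  rw [lintegral_finsetSum _ fun σ _ => measurable_const.indicator (measurableSet_cylinder h σ)]
  refine Finset.sum_congr rfl fun σ _ => ?_
  rw [lintegral_indicator (measurableSet_cylinder h σ), setLIntegral_const]

theorem sum_measure_cylinder {j : ℕ} (h : (j : ℕ∞) ≤ N) (m : Measure Γ.Ray)
    [IsProbabilityMeasure m] : ∑ σ, m {ξ | ξ.vertex j h = σ} = 1 := by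
  have := sum_measure_preimage_singleton (μ := m) (f := fun ξ : Γ.Ray => ξ.vertex j h)
    Finset.univ fun σ _ => measurableSet_cylinder h σ
  rw [Finset.coe_univ, Set.preimage_univ, measure_univ] at this
  exact this

/-- Tonelli applied to the layered kernel: the energy is a weighted sum, with weights independent of
m, of the probabilities that two independent rays agree in level j. -/
theorem energy_eq_tsum {p : ℕ → ℝ≥0∞} (hp : Antitone p) (m : Measure Γ.Ray) :
    Γ.energy p m = ∑' j, increment (fun k => (p k)⁻¹) j * ∫⁻ ξ, m {η | Γ.Agree ξ η j} ∂m := by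
  classical
  unfold energy
  have hin : ∀ ξ : Γ.Ray, ∫⁻ η, (gaugeAt p (Γ.meetDepth ξ η))⁻¹ ∂m =
      ∑' j, increment (fun k => (p k)⁻¹) j * m {η | Γ.Agree ξ η j} := by
    intro ξ
    have hmeas : ∀ j, Measurable ({η | Γ.Agree ξ η j}.indicator fun _ => (1 : ℝ≥0∞)) := fun j =>
      measurable_const.indicator (measurableSet_agree ξ j)
    calc ∫⁻ η, (gaugeAt p (Γ.meetDepth ξ η))⁻¹ ∂m
        = ∫⁻ η, ∑' j, increment (fun k => (p k)⁻¹) j *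
            {η | Γ.Agree ξ η j}.indicator (fun _ => (1 : ℝ≥0∞)) η ∂m := by
          refine lintegral_congr fun η => ?_
          rw [inv_gaugeAt_meetDepth hp]
          refine tsum_congr fun j => ?_
          simp [Set.indicator_apply]
      _ = _ := by
          rw [lintegral_tsum fun j => ((hmeas j).const_mul _).aemeasurable]
          refine tsum_congr fun j => ?_
          rw [lintegral_const_mul _ (hmeas j), lintegral_indicator (measurableSet_agree ξ j),
            setLIntegral_const, one_mul]
  simp only [hin]
  rw [lintegral_tsum fun j => ((measurable_measure_agree m j).const_mul _).aemeasurable]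
  exact tsum_congr fun j => lintegral_const_mul _ (measurable_measure_agree m j)

theorem invCard_le_lintegral_measure_agree (m : Measure Γ.Ray) [IsProbabilityMeasure m] (j : ℕ) :
    Γ.invCard j ≤ ∫⁻ ξ, m {η | Γ.Agree ξ η j} ∂m := by
  by_cases h : (j : ℕ∞) ≤ N
  · rw [lintegral_measure_agree h, Γ.invCard_of_le h, card_eq_fintype]
    exact inv_card_le_sum_sq (sum_measure_cylinder h m)
  · rw [Γ.invCard_of_lt (not_le.1 h)]
    exact zero_le

theorem lintegral_measure_agree_of_uniform {m : Measure Γ.Ray} [IsProbabilityMeasure m]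
    (hm : ∀ (n : ℕ) (h : (n : ℕ∞) ≤ N) (σ τ : Γ.level n),
      m {ξ | ξ.vertex n h = σ} = m {ξ | ξ.vertex n h = τ}) (j : ℕ) :
    ∫⁻ ξ, m {η | Γ.Agree ξ η j} ∂m = Γ.invCard j := by
  by_cases h : (j : ℕ∞) ≤ N
  · have hne := Γ.level_nonempty h
    obtain ⟨τ⟩ := hne
    have hs := sum_measure_cylinder h m
    rw [lintegral_measure_agree h, Γ.invCard_of_le h, card_eq_fintype]
    simp only [fun σ => hm j h σ τ, Finset.sum_const, Finset.card_univ, nsmul_eq_mul] at hs ⊢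
    rw [← mul_assoc, hs, one_mul]
    exact ENNReal.eq_inv_of_mul_eq_one_left (by rw [mul_comm]; exact hs)
  · rw [Γ.invCard_of_lt (not_le.1 h)]
    have : ∀ ξ : Γ.Ray, {η | Γ.Agree ξ η j} = ∅ := fun ξ => by
      ext η
      exact ⟨fun ⟨h1, _⟩ => h h1, fun h => h.elim⟩
    simp [this]

/-! ### The uniform measure on the boundary of a spherically symmetric tree -/

variable {c : ℕ → ℕ}
  (e : ∀ n : ℕ, ((n + 1 : ℕ) : ℕ∞) ≤ N → ∀ σ : Γ.level n,
    Fin (c n) ≃ {τ : Γ.level (n + 1) // Γ.parent n τ = σ})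

/-- The vertex reached from the root by choosing children according to a sequence of digits. -/
def digitVertex (z : ∀ i, Fin (c i)) : ∀ n : ℕ, (n : ℕ∞) ≤ N → Γ.level n
  | 0, _ => Γ.root
  | n + 1, h => (e n h (digitVertex z n (le_trans (by exact_mod_cast n.le_succ) h)) (z n)).1

/-- The ray given by a sequence of digits. -/
def digitRay (z : ∀ i, Fin (c i)) : Γ.Ray where
  vertex := digitVertex e z
  parent_vertex n h h' := (e n h' (digitVertex e z n h) (z n)).2

/-- Distinct digits lead to distinct children, so a vertex of level n determines the first n digits.
Thus cylinders of rays pull back to cylinders of digits, which gives both measurability and the mass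
of a vertex. -/
theorem exists_setOf_digitVertex_eq [∀ i, NeZero (c i)] (n : ℕ) (h : (n : ℕ∞) ≤ N)
    (σ : Γ.level n) :
    ∃ w : ∀ i, Fin (c i), {z | digitVertex e z n h = σ} =
      (Finset.range n : Set ℕ).pi fun i => {w i} := by
  induction n with
  | zero =>
    refine ⟨fun i => 0, ?_⟩
    ext z
    simp [digitVertex, Γ.eq_root σ]
  | succ n ih =>
    have h' : (n : ℕ∞) ≤ N := le_trans (by exact_mod_cast n.le_succ) h
    obtain ⟨w, hw⟩ := ih h' (Γ.parent n σ)
    refine ⟨Function.update w n ((e n h (Γ.parent n σ)).symm ⟨σ, rfl⟩), ?_⟩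
    ext z
    have hz := Set.ext_iff.1 hw z
    simp only [Set.mem_ofPred_eq, Set.mem_pi, Finset.coe_range, Set.mem_Iio,
      Set.mem_singleton_iff] at hz ⊢
    have hstep : digitVertex e z (n + 1) h = σ ↔ digitVertex e z n h' = Γ.parent n σ ∧
        z n = (e n h (Γ.parent n σ)).symm ⟨σ, rfl⟩ := by
      constructor
      · intro hv
        have hp : digitVertex e z n h' = Γ.parent n σ := by
          rw [← hv]; exact ((digitRay e z).parent_vertex n h' h).symm
        refine ⟨hp, ?_⟩
        rw [Equiv.eq_symm_apply]
        refine Subtype.ext ?_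
        -- The two children live in subtypes indexed by different expressions for their parent, so
        -- they are compared as vertices.
        have : (e n h (digitVertex e z n h') (z n)).1 = (e n h (Γ.parent n σ) (z n)).1 := by
          rw [hp]
        exact this.symm.trans hv
      · rintro ⟨hp, hd⟩
        rw [Equiv.eq_symm_apply] at hd
        have : (e n h (digitVertex e z n h') (z n)).1 = (e n h (Γ.parent n σ) (z n)).1 := by
          rw [hp]
        exact this.trans (congrArg Subtype.val hd)
    rw [hstep, hz]
    constructor
    · rintro ⟨h1, h2⟩ i hi
      rcases Nat.lt_succ_iff_lt_or_eq.1 hi with hi' | rfl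
      · rw [Function.update_of_ne hi'.ne]; exact h1 i hi'
      · rw [Function.update_self]; exact h2
    · intro h1
      refine ⟨fun i hi => ?_, ?_⟩
      · have := h1 i (by omega)
        rwa [Function.update_of_ne hi.ne] at this
      · have := h1 n (by omega)
        rwa [Function.update_self] at this

theorem measurable_digitRay [∀ i, NeZero (c i)] : Measurable (digitRay e) := by
  refine measurable_generateFrom ?_
  rintro _ ⟨n, h, σ, rfl⟩
  obtain ⟨w, hw⟩ := exists_setOf_digitVertex_eq e n h σ
  have : digitRay e ⁻¹' {ξ : Γ.Ray | ξ.vertex n h = σ} =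
      (Finset.range n : Set ℕ).pi fun i => {w i} := hw
  rw [this]
  exact MeasurableSet.pi (Finset.countable_toSet _) fun i _ => measurableSet_singleton _

/-- The law of the ray that picks a uniform child at every step: the image of a product of uniform
digit laws. For finite `N` the digits beyond the height are simply ignored. -/
theorem exists_uniform_measure_of_equiv [∀ i, NeZero (c i)]
    (e : ∀ n : ℕ, ((n + 1 : ℕ) : ℕ∞) ≤ N → ∀ σ : Γ.level n,
      Fin (c n) ≃ {τ : Γ.level (n + 1) // Γ.parent n τ = σ}) :
    ∃ m : Measure Γ.Ray, IsProbabilityMeasure m ∧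
      ∀ (n : ℕ) (h : (n : ℕ∞) ≤ N) (σ τ : Γ.level n),
        m {ξ | ξ.vertex n h = σ} = m {ξ | ξ.vertex n h = τ} := by
  let ν : Measure (∀ i, Fin (c i)) :=
    Measure.infinitePi fun i => (PMF.uniformOfFintype (Fin (c i))).toMeasure
  refine ⟨ν.map (digitRay e), Measure.isProbabilityMeasure_map (measurable_digitRay e).aemeasurable,
    ?_⟩
  have key : ∀ (n : ℕ) (h : (n : ℕ∞) ≤ N) (σ : Γ.level n),
      ν.map (digitRay e) {ξ | ξ.vertex n h = σ} = ∏ i ∈ Finset.range n, (c i : ℝ≥0∞)⁻¹ := by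
    intro n h σ
    obtain ⟨w, hw⟩ := exists_setOf_digitVertex_eq e n h σ
    have hpre : digitRay e ⁻¹' {ξ : Γ.Ray | ξ.vertex n h = σ} =
        (Finset.range n : Set ℕ).pi fun i => {w i} := hw
    rw [Measure.map_apply (measurable_digitRay e) (measurableSet_cylinder h σ), hpre,
      Measure.infinitePi_pi _ fun i _ => measurableSet_singleton _]
    refine Finset.prod_congr rfl fun i _ => ?_
    rw [PMF.toMeasure_apply_singleton _ _ (measurableSet_singleton _)]
    simp
  intro n h σ τ
  rw [key, key]

variable {f : ℕ → ℝ}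

theorem IsSphericallySymmetric.exists_uniform_measure (hΓ : Γ.IsSphericallySymmetric f) :
    ∃ m : Measure Γ.Ray, IsProbabilityMeasure m ∧
      ∀ (n : ℕ) (h : (n : ℕ∞) ≤ N) (σ τ : Γ.level n),
        m {ξ | ξ.vertex n h = σ} = m {ξ | ξ.vertex n h = τ} := by
  -- One dummy digit is kept beyond the height, so that no digit space is empty.
  let c : ℕ → ℕ := fun n => if ((n + 1 : ℕ) : ℕ∞) ≤ N then ⌊f n⌋₊ else 1
  have hc : ∀ (n : ℕ), ((n + 1 : ℕ) : ℕ∞) ≤ N → ∀ σ : Γ.level n,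
      Nat.card {τ : Γ.level (n + 1) // Γ.parent n τ = σ} = c n := by
    intro n h σ
    simp only [c, if_pos h, ← hΓ n h σ, Nat.floor_natCast]
  have hne : ∀ i, NeZero (c i) := by
    intro i
    refine ⟨?_⟩
    by_cases h : ((i + 1 : ℕ) : ℕ∞) ≤ N
    · obtain ⟨σ⟩ := Γ.level_nonempty (le_trans (by exact_mod_cast i.le_succ) h : (i : ℕ∞) ≤ N)
      rw [← hc i h σ]
      obtain ⟨τ, hτ⟩ := Γ.exists_child i h σ
      have : Nonempty {τ : Γ.level (i + 1) // Γ.parent i τ = σ} := ⟨⟨τ, hτ⟩⟩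
      exact Nat.card_pos.ne'
    · simp only [c, if_neg h]; exact one_ne_zero
  exact exists_uniform_measure_of_equiv fun n h σ =>
    (Finite.equivFinOfCardEq (hc n h σ)).symm

/-! ### Capacity and existence of spherically symmetric trees -/

theorem IsSphericallySymmetric.card_succ (hΓ : Γ.IsSphericallySymmetric f) {n : ℕ}
    (h : ((n + 1 : ℕ) : ℕ∞) ≤ N) : (Γ.card (n + 1) : ℝ) = Γ.card n * f n := by
  have h1 : Γ.card (n + 1) = ∑ σ : Γ.level n,
      Nat.card {τ : Γ.level (n + 1) // Γ.parent n τ = σ} := by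
    rw [card, ← Nat.card_sigma, Nat.card_congr (Equiv.sigmaFiberEquiv (Γ.parent n))]
  rw [h1]
  push_cast
  rw [Finset.sum_congr rfl fun σ _ => hΓ n h σ]
  simp [card_eq_fintype]

/-- Cauchy–Schwarz bounds the energy below level by level with nonnegative weights, and the uniform
measure attains equality in every level simultaneously. -/
theorem capacity_eq_of_isSphericallySymmetric (hΓ : Γ.IsSphericallySymmetric f) {p : ℕ → ℝ≥0∞}
    (hp : Antitone p) :
    Γ.capacity p = (∑' j, increment (fun k => (p k)⁻¹) j * Γ.invCard j)⁻¹ := by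
  unfold capacity
  congr 1
  refine le_antisymm ?_ ?_
  · obtain ⟨m, hm, hunif⟩ := hΓ.exists_uniform_measure
    refine iInf₂_le_of_le m hm ?_
    rw [energy_eq_tsum hp]
    simp only [lintegral_measure_agree_of_uniform hunif, le_refl]
  · refine le_iInf₂ fun m hm => ?_
    rw [energy_eq_tsum hp]
    exact ENNReal.tsum_le_tsum fun j =>
      mul_le_mul_right (invCard_le_lintegral_measure_agree m j) _

theorem IsSphericallySymmetric.card_eq {Λ : LevelTree.{u} N}
    (hΛ : Λ.IsSphericallySymmetric Γ.growth) {n : ℕ} (h : (n : ℕ∞) ≤ N) :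
    Λ.card n = Γ.card n := by
  induction n with
  | zero => rw [card_zero, card_zero]
  | succ n ih =>
    have h' : (n : ℕ∞) ≤ N := le_trans (by exact_mod_cast n.le_succ) h
    have h0 : (Γ.card n : ℝ) ≠ 0 := by exact_mod_cast (Γ.card_pos h').ne'
    have := hΛ.card_succ h
    rw [ih h', growth, mul_div_cancel₀ _ h0] at this
    exact_mod_cast this

theorem tendsto_invCard (hΓ : N = ⊤ → ∀ M : ℕ, ∃ n : ℕ, M ≤ Γ.card n) :
    Filter.Tendsto Γ.invCard Filter.atTop (nhds 0) := by
  by_cases hN : N = ⊤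
  · subst hN
    have hmono : Monotone Γ.card := monotone_nat_of_le_succ fun n => Γ.card_le_card_succ le_top
    have h := ENNReal.tendsto_inv_nat_nhds_zero.comp
      (Filter.tendsto_atTop_atTop_of_monotone hmono (hΓ rfl))
    exact h.congr fun n => (Γ.invCard_of_le le_top).symm
  · obtain ⟨n, rfl⟩ := ENat.ne_top_iff_exists.1 hN
    refine tendsto_const_nhds.congr' ?_
    filter_upwards [Filter.eventually_gt_atTop n] with k hk
    exact (Γ.invCard_of_lt (by exact_mod_cast hk)).symm

/-- Both trees have the same level sizes, so the two formulas differ only by summation by parts. Its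
limit condition is where unbounded level sizes enter when `N` is infinite. -/
theorem resistanceBound_eq_two_mul_capacity (hΓ : N = ⊤ → ∀ M : ℕ, ∃ n : ℕ, M ≤ Γ.card n)
    {Λ : LevelTree.{u} N} (hΛ : Λ.IsSphericallySymmetric Γ.growth) {p : ℕ → ℝ≥0∞}
    (hp : Antitone p) : resistanceBound Γ p = 2 * Λ.capacity p := by
  have hinv : Λ.invCard = Γ.invCard := by
    ext n
    by_cases h : (n : ℕ∞) ≤ N
    · rw [invCard_of_le _ h, invCard_of_le _ h, hΛ.card_eq h]
    · rw [invCard_of_lt _ (not_le.1 h), invCard_of_lt _ (not_le.1 h)]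
  rw [resistanceBound_eq_tsum, capacity_eq_of_isSphericallySymmetric hΛ hp, hinv]
  congr 2
  exact tsum_mul_sub_succ (a := fun k => (p k)⁻¹) (fun i j h => ENNReal.inv_le_inv.2 (hp h))
    Γ.invCard_antitone (ne_top_of_le_ne_top ENNReal.one_ne_top (Γ.invCard_le_one 0))
    (tendsto_invCard hΓ)

/-- The spherically symmetric tree of height `N` in which a vertex of level `n` has `c n`
children. -/
def spherical (N : ℕ∞) (c : ℕ → ℕ) (hc : ∀ n : ℕ, ((n + 1 : ℕ) : ℕ∞) ≤ N → 0 < c n) :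
    LevelTree.{u} N where
  level n := ULift.{u} {_σ : ∀ i : Fin n, Fin (c i) // (n : ℕ∞) ≤ N}
  parent n σ := ⟨⟨fun i => σ.down.1 i.castSucc,
    le_trans (by exact_mod_cast n.le_succ) σ.down.2⟩⟩
  root := ⟨⟨fun i => i.elim0, by simp⟩⟩
  eq_root σ := by
    refine ULift.ext _ _ (Subtype.ext ?_)
    ext i
    exact i.elim0
  finite_level n := inferInstance
  exists_child n h σ := by
    refine ⟨⟨⟨Fin.snoc (α := fun i : Fin (n + 1) => Fin (c i)) σ.down.1 ⟨0, hc n h⟩, h⟩⟩, ?_⟩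
    refine ULift.ext _ _ (Subtype.ext ?_)
    funext i
    simp
  isEmpty_level n h := ⟨fun σ => h.not_ge σ.down.2⟩

theorem isSphericallySymmetric_spherical {c : ℕ → ℕ}
    (hc : ∀ n : ℕ, ((n + 1 : ℕ) : ℕ∞) ≤ N → 0 < c n) :
    (spherical.{u} N c hc).IsSphericallySymmetric fun n => c n := by
  intro n h σ
  let φ : {τ : (spherical.{u} N c hc).level (n + 1) // (spherical.{u} N c hc).parent n τ = σ} ≃
      Fin (c n) :=
    { toFun := fun τ => τ.1.down.1 (Fin.last n)
      invFun := fun x => ⟨⟨⟨Fin.snoc (α := fun i : Fin (n + 1) => Fin (c i)) σ.down.1 x, h⟩⟩, by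
        refine ULift.ext _ _ (Subtype.ext ?_)
        funext i
        simp [spherical]⟩
      left_inv := by
        rintro ⟨τ, rfl⟩
        refine Subtype.ext (ULift.ext _ _ (Subtype.ext ?_))
        funext i
        refine Fin.lastCases ?_ (fun i => ?_) i
        · simp
        · simp [spherical]
      right_inv := fun x => by simp }
  rw [Nat.card_congr φ, Nat.card_fin]

theorem exists_isSphericallySymmetric_growth (Γ : LevelTree.{u} N)
    (hΓ : ∀ n : ℕ, ((n + 1 : ℕ) : ℕ∞) ≤ N → ∃ m : ℕ, Γ.growth n = m) :
    ∃ Λ : LevelTree.{u} N, Λ.IsSphericallySymmetric Γ.growth := by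
  have hfl : ∀ n : ℕ, ((n + 1 : ℕ) : ℕ∞) ≤ N → (⌊Γ.growth n⌋₊ : ℝ) = Γ.growth n := by
    intro n h
    obtain ⟨m, hm⟩ := hΓ n h
    rw [hm, Nat.floor_natCast]
  have hc : ∀ n : ℕ, ((n + 1 : ℕ) : ℕ∞) ≤ N → 0 < ⌊Γ.growth n⌋₊ := fun n h =>
    Nat.floor_pos.2 (Γ.one_le_growth h)
  refine ⟨spherical N (fun n => ⌊Γ.growth n⌋₊) hc, fun n h σ => ?_⟩
  exact (isSphericallySymmetric_spherical hc n h σ).trans (hfl n h)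

end LevelTree

end

theorem theorem4p2 {N : ℕ∞} (Γ : LevelTree.{u} N)
    (μ : Measure ℝ) [IsProbabilityMeasure μ]
    {Ω : Type*} [MeasurableSpace Ω] (P : Measure Ω) [IsProbabilityMeasure P]
    (X : Γ.NonRoot → Ω → ℝ) (hX : ∀ σ, Measurable (X σ)) (hlaw : ∀ σ, P.map (X σ) = μ)
    (hindep : iIndepFun X P)
    (B : Set (RPow N)) (hB : IsClosed B) :
    -- `levelProb μ B n` is `P(B; ρ ↔ σ)` for every vertex `σ` with `|σ| = n`
    (∀ (n : ℕ) (σ : Γ.level n),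
      P {ω | Γ.ConnVertex B (fun τ => X τ ω) n σ} = levelProb μ B n) ∧
    -- thresholds defining `S(B)` exist whenever the labels have an atomless law
    (∀ ν : Measure ℝ, IsProbabilityMeasure ν → (∀ x : ℝ, ν {x} = 0) →
      ∃ b : ℕ → EReal, MatchesLevels N ν (levelProb μ B) b) ∧
    -- the chain of inequalities
    (∀ ν : Measure ℝ, IsProbabilityMeasure ν →
      ∀ b : ℕ → EReal, MatchesLevels N ν (levelProb μ B) b →
        P {ω | Γ.ConnBoundary B (fun τ => X τ ω)} ≤ virtualConn μ B Γ.growth ∧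
        virtualConn μ B Γ.growth ≤ virtualConn ν (productTarget N b) Γ.growth ∧
        virtualConn ν (productTarget N b) Γ.growth ≤ resistanceBound Γ (levelProb μ B)) ∧
    -- the case in which `S(Γ)` exists as a tree
    ((∀ n : ℕ, ((n + 1 : ℕ) : ℕ∞) ≤ N → ∃ m : ℕ, Γ.growth n = m) →
      (∃ Λ : LevelTree.{u} N, Λ.IsSphericallySymmetric Γ.growth) ∧
      ((N = ⊤ → ∀ M : ℕ, ∃ n : ℕ, M ≤ Γ.card n) →
        ∀ Λ : LevelTree.{u} N, Λ.IsSphericallySymmetric Γ.growth →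
          resistanceBound Γ (levelProb μ B) = 2 * Λ.capacity (levelProb μ B))) := by
  refine ⟨Γ.measure_connVertex hX hlaw hindep hB, fun ν hν hatom =>
    exists_matchesLevels N ν hatom (levelProb_zero μ B) (levelProb_antitone μ B),
    fun ν hν b hb => ⟨Γ.measure_connBoundary_le_virtualConn hX hlaw hindep hB,
      Γ.virtualConn_le_virtualConn_productTarget μ ν hB hb,
      Γ.virtualConn_productTarget_le_resistanceBound ν hb⟩,
    fun hint => ⟨LevelTree.exists_isSphericallySymmetric_growth Γ hint, fun hΓ Λ hΛ =>
      LevelTree.resistanceBound_eq_two_mul_capacity hΓ hΛ (levelProb_antitone μ B)⟩⟩
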